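/- **Setting.** Let $n\ge 3$ agents produce outputs $\boldsymbol x=(x_1,\dots,x_n)\in\mathbb R_{\ge 0}^n$. With $s_{-i}=\sum_{j\ne i}x_j$, agent $i$ has utility $$u(x_i,s_{-i})=\frac{x_i}{x_i+s_{-i}}-\frac{n-1}{n^2}\,c(x_i),$$ where the first term is read as $1/n$ if all outputs are $0$. The common cost function $c:[0,\infty)\to\mathbb R$ is *admissible* if it is twice differentiable (one-sidedly at $0$), $c'(z)>0$ for $z>0$, $c''\ge 0$, $c(0)=0$ and $c'(1)=1$. For $s>0$ let $BR(s)$ be the unique maximiser of $u(z,s)$ over $z\ge 0$, and put $BR(0)=a$ for a fixed $a\in(0,1)$. Best-response dynamics starts at a profile $\boldsymbol x_0$; at each step $t\ge 0$ one selected agent $i_t$ replaces her output by $BR(s_{t,-i_t})$ and the others keep theirs. A profile $\boldsymbol x$ is an $\varepsilon$-approximate equilibrium if $u(x_i,s_{-i})\ge(1-\varepsilon)\,u(y,s_{-i})$ for all $i$ and all $y\ge 0$. Let $$\gamma(\boldsymbol x_0)=\min\big(\{a\}\cup\{x_{0,j}: x_{0,j}>0\}\cup\mathcal B\big),$$ where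 $\mathcal B=\{BR(x_{0,j}+1): j\le n\}$ if $c'(0)=0$, and, if $c'(0)>0$, with $\kappa=\frac{n^2}{c'(0)(n-1)}$, $$\mathcal B=\Big\{\min\Big(\tfrac{\kappa-x_{0,j}}{2},\,BR\big(\tfrac{\kappa+x_{0,j}}{2}\big)\Big): j\le n,\ x_{0,j}<\kappa\Big\}.$$ Write $\ell(\gamma)=\max(0,\log\log(1/\gamma))$. **Theorem.** (Upper bound, best-case selection.) There is an absolute constant $C>0$ such that for all $n\ge 3$, $a\in(0,1)$, admissible $c$, $\varepsilon\in(0,1)$, all $K$ for which $c$ is $K$-Lipschitz on $[1-\varepsilon,1+\varepsilon]$, and all initial profiles $\boldsymbol x_0$, there is a sequence of agent selections for which the dynamics reaches an $\varepsilon$-approximate equilibrium within $C\big(\ell(\gamma(\boldsymbol x_0))+n\log(nK/\varepsilon)\big)$ steps. (Lower bound, every selection process.) For every $\varepsilon_1\in(0,1)$ there is a constant $C>0$, depending only on $\varepsilon_1$, such that for all $n\ge 3$, $a\in(0,1)$, $\varepsilon\in(0,\varepsilon_1]$, $\gamma\in(0,\min(a,\tfrac14)]$ and $K\ge 1$ there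 are an admissible $c$ with $c'(0)>0$ that is $K$-Lipschitz on $[1-\varepsilon,1+\varepsilon]$ and an initial profile $\boldsymbol x_0$ with $\gamma(\boldsymbol x_0)=\gamma$ such that, for every sequence of agent selections, each $t$ at which $\boldsymbol x_t$ is an $\varepsilon$-approximate equilibrium satisfies $$t\ \ge\ C\Big(n+\ell(\gamma)+\frac{\log(1/\varepsilon)}{\log n}\Big).$$ -/

import Mathlib

noncomputable section

namespace Tullock

/-- Marginal cost `c'` on `[0, ∞)` (one-sided at `0`). -/
def marginal (c : ℝ → ℝ) : ℝ → ℝ := derivWithin c (Set.Ici 0)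

/-- Admissible (normalised) cost functions on `[0, ∞)`: twice differentiable, strictly positive
marginal cost at every positive output, convex, `c 0 = 0`, and normalised by `c' 1 = 1`.
The value `c' 0 = 0` is allowed. Values of `c` at negative reals are irrelevant. -/
structure IsCost (c : ℝ → ℝ) : Prop where
  differentiableOn : DifferentiableOn ℝ c (Set.Ici 0)
  marginal_differentiableOn : DifferentiableOn ℝ (marginal c) (Set.Ici 0)
  marginal_pos : ∀ z : ℝ, 0 < z → 0 < marginal c z
  convex : ∀ z : ℝ, 0 ≤ z → 0 ≤ derivWithin (marginal c) (Set.Ici 0) z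
  zero : c 0 = 0
  marginal_one : marginal c 1 = 1

/-- Utility of an agent with output `z` when the others produce `s` in total. The unit prize is
shared in proportion to the outputs, equally if all outputs vanish; the cost is
`(n - 1) / n ^ 2 * c z`. -/
def utility (n : ℕ) (c : ℝ → ℝ) (z s : ℝ) : ℝ :=
  (if z + s = 0 then 1 / (n : ℝ) else z / (z + s)) - ((n : ℝ) - 1) / (n : ℝ) ^ 2 * c z

/-- Total output of all agents except `i`. -/
def others {n : ℕ} (x : Fin n → ℝ) (i : Fin n) : ℝ :=
  ∑ j ∈ Finset.univ.erase i, x j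

/-- Best response to a total output `s` of the others: the (unique) maximiser over `z ≥ 0` of the
utility if `s > 0`, and by convention `a` if `s = 0`. -/
def bestResponse (n : ℕ) (c : ℝ → ℝ) (a s : ℝ) : ℝ :=
  if s = 0 then a
  else Classical.epsilon fun z : ℝ => 0 ≤ z ∧ ∀ y : ℝ, 0 ≤ y → utility n c y s ≤ utility n c z s

/-- Best-response dynamics from `x₀`: at step `t` agent `i t` switches to her best response. -/
def dynamics {n : ℕ} (c : ℝ → ℝ) (a : ℝ) (x₀ : Fin n → ℝ) (i : ℕ → Fin n) : ℕ → Fin n → ℝ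
  | 0 => x₀
  | t + 1 => Function.update (dynamics c a x₀ i t) (i t)
      (bestResponse n c a (others (dynamics c a x₀ i t) (i t)))

/-- `x` is an `ε`-approximate pure-strategy Nash equilibrium. -/
def IsApproxEquilibrium {n : ℕ} (c : ℝ → ℝ) (ε : ℝ) (x : Fin n → ℝ) : Prop :=
  ∀ i : Fin n, ∀ y : ℝ, 0 ≤ y →
    (1 - ε) * utility n c y (others x i) ≤ utility n c (x i) (others x i)

/-- The output level `n ^ 2 / (c' 0 * (n - 1))` (meaningful for `c' 0 > 0`): best responses to a
total output at or above it vanish. -/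
def threshold (n : ℕ) (c : ℝ → ℝ) : ℝ := (n : ℝ) ^ 2 / (marginal c 0 * ((n : ℝ) - 1))

/-- The part of the defining set of `gammaOf` that comes from best responses. -/
def responseSet {n : ℕ} (c : ℝ → ℝ) (a : ℝ) (x₀ : Fin n → ℝ) : Set ℝ :=
  {y | (marginal c 0 = 0 ∧ ∃ j : Fin n, y = bestResponse n c a (x₀ j + 1)) ∨
    (0 < marginal c 0 ∧ ∃ j : Fin n, x₀ j < threshold n c ∧
      y = min ((threshold n c - x₀ j) / 2) (bestResponse n c a ((threshold n c + x₀ j) / 2)))}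

/-- The parameter `γ` of the initial profile: the minimum of a finite nonempty set. -/
def gammaOf {n : ℕ} (c : ℝ → ℝ) (a : ℝ) (x₀ : Fin n → ℝ) : ℝ :=
  sInf ({a} ∪ {y | ∃ j : Fin n, 0 < x₀ j ∧ y = x₀ j} ∪ responseSet c a x₀)

/-- `c` is `K`-Lipschitz on `[1 - ε, 1 + ε]`. -/
def LipschitzNearOne (c : ℝ → ℝ) (K ε : ℝ) : Prop :=
  ∀ z ∈ Set.Icc (1 - ε) (1 + ε), ∀ w ∈ Set.Icc (1 - ε) (1 + ε), |c z - c w| ≤ K * |z - w|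

/-- `log log (1 / γ)`, read as `0` where it is negative, that is, for `1 / e < γ < 1`. -/
def logLog (γ : ℝ) : ℝ := max 0 (Real.log (Real.log (1 / γ)))

end Tullock

end

/-!
Write `N = n - 1`, let `s` be the total output of the other agents, and let `κ = n ^ 2 / N` for
linear cost. At the symmetric equilibrium all outputs are `1`.

**Upper bound.** The first-order condition `n ^ 2 * s = N * c' z * (z + s) ^ 2` for `z = BR(s)`,
together with `c' 1 = 1` and the monotonicity of `c'`, places `BR(s)` between `1` and the best
response `√(κ * s) - s` under linear cost. Hence `BR(s) - 1 = -β * (s - N)` with `0 ≤ β ≤ 1 / 2`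
whenever `s ≥ 1 / N` (`bestResponse_bounds_of_le`, `bestResponse_bounds_of_ge`). The selection has
three phases.

* `exists_reaches_moderate`: the agents whose output exceeds every possible best response move
  once each. The order is chosen so that the total output stays at least `γ`; this is what `γ` is
  designed for.
* `exists_reaches_one`: while the total output `S` is below `1`, the agent with minimal output
  moves. The new total is at least `√(3 * S)` (or `1`), so that doubly logarithmically many steps
  lead to a total of at least `1`.
* `exists_contraction`: let `P` and `Q` be the sums of the positive and of the negative parts of the
  `x j - 1`. If `P ≥ Q` the agent with maximal output moves, otherwise the one with minimal output.
  The bound `β ≤ 1 / 2` implies that `max P Q` shrinks by the factor `1 - 1 / (2 * n)` within two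
  moves. Once `max P Q ≤ ε / (6 * n ^ 2 * K)`, the profile is an `ε`-approximate equilibrium,
  because the best utility is then at least `2 / (3 * n ^ 2)` (`isApproxEquilibrium_of_near`).

**Lower bound.** Take linear cost and let two agents start at `γ`, the others at `0`. All totals `s`
stay in `(0, κ)`, and the loss of an agent against her best response is the square of
`√(S / κ) - √(s / S)` (`Live.abs_sqrt_sub_sqrt_le`). In an approximate equilibrium, therefore:

* no output vanishes, so that at least `n - 2` steps have been made;
* `S / κ` is bounded below in terms of `ε₁`, because the last mover's share is `1 - S / κ` and the
  other agents need a share as well; but each move replaces `S / κ` by at most its square root;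
* all outputs are within `9 * n * √ε` of `1`; but if two outputs are at distance `d` or more from
  `1`, then after any move two outputs are at distance `d / n ^ 4` or more (`Far.move`).
-/

namespace Tullock

/-! ### Cost functions -/

namespace IsCost

variable {c : ℝ → ℝ}

theorem hasDerivWithinAt (hc : IsCost c) {z : ℝ} (hz : 0 ≤ z) :
    HasDerivWithinAt c (marginal c z) (Set.Ici 0) z :=
  (hc.differentiableOn z hz).hasDerivWithinAt

theorem deriv_eq_marginal {z : ℝ} (hz : 0 < z) : deriv c z = marginal c z :=
  (derivWithin_of_mem_nhds (Ici_mem_nhds hz)).symm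

theorem monotoneOn_marginal (hc : IsCost c) : MonotoneOn (marginal c) (Set.Ici 0) := by
  refine monotoneOn_of_deriv_nonneg (convex_Ici 0) hc.marginal_differentiableOn.continuousOn
    (hc.marginal_differentiableOn.mono interior_subset) fun z hz => ?_
  rw [interior_Ici] at hz
  rw [← derivWithin_of_mem_nhds (Ici_mem_nhds hz)]
  exact hc.convex z hz.le

theorem marginal_zero_nonneg (hc : IsCost c) : 0 ≤ marginal c 0 := by
  have h : Filter.Tendsto (marginal c) (nhdsWithin 0 (Set.Ioi 0)) (nhds (marginal c 0)) :=
    (hc.marginal_differentiableOn.continuousOn 0 (Set.mem_Ici.2 le_rfl)).mono_left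
      (nhdsWithin_mono _ Set.Ioi_subset_Ici_self)
  exact ge_of_tendsto h (eventually_nhdsWithin_of_forall fun z hz => (hc.marginal_pos z hz).le)

theorem convexOn (hc : IsCost c) : ConvexOn ℝ (Set.Ici 0) c := by
  refine MonotoneOn.convexOn_of_deriv (convex_Ici 0) hc.differentiableOn.continuousOn
    (hc.differentiableOn.mono interior_subset) fun x hx y hy hxy => ?_
  rw [interior_Ici] at hx hy
  rw [deriv_eq_marginal hx, deriv_eq_marginal hy]
  exact hc.monotoneOn_marginal (Set.mem_Ici.2 (le_of_lt hx)) (Set.mem_Ici.2 (le_of_lt hy)) hxy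

theorem marginal_le_one (hc : IsCost c) {z : ℝ} (hz : 0 ≤ z) (hz1 : z ≤ 1) : marginal c z ≤ 1 :=
  (hc.monotoneOn_marginal hz (Set.mem_Ici.2 zero_le_one) hz1).trans_eq hc.marginal_one

theorem one_le_marginal (hc : IsCost c) {z : ℝ} (hz1 : 1 ≤ z) : 1 ≤ marginal c z :=
  hc.marginal_one.symm.trans_le
    (hc.monotoneOn_marginal (Set.mem_Ici.2 zero_le_one) (zero_le_one.trans hz1) hz1)

/-- The tangent to the cost curve at output `1` lies below the curve. -/
theorem tangent_le (hc : IsCost c) {z : ℝ} (hz : 0 ≤ z) : c 1 + (z - 1) ≤ c z := by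
  have h1 : HasDerivAt c 1 1 := by
    have := (hc.hasDerivWithinAt zero_le_one).hasDerivAt (Ici_mem_nhds one_pos)
    rwa [hc.marginal_one] at this
  rcases lt_trichotomy z 1 with h | h | h
  · have := hc.convexOn.slope_le_of_hasDerivAt (x := z) (y := 1) hz
      (Set.mem_Ici.2 zero_le_one) h h1
    rw [slope_def_field, div_le_iff₀ (by linarith)] at this
    linarith
  · subst h; linarith
  · have := hc.convexOn.le_slope_of_hasDerivAt (x := 1) (y := z)
      (Set.mem_Ici.2 zero_le_one) hz h h1
    rw [slope_def_field, le_div_iff₀ (by linarith)] at this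
    linarith

theorem apply_one_le (hc : IsCost c) : c 1 ≤ 1 := by
  have := hc.tangent_le le_rfl
  rw [hc.zero] at this
  linarith

theorem one_le_lipschitz (hc : IsCost c) {K ε : ℝ} (hε : 0 < ε) (hK : LipschitzNearOne c K ε) :
    1 ≤ K := by
  have h1 := hK (1 + ε) ⟨by linarith, le_rfl⟩ 1 ⟨by linarith, by linarith⟩
  have h2 := hc.tangent_le (z := 1 + ε) (by linarith)
  have h3 := le_abs_self (c (1 + ε) - c 1)
  rw [show 1 + ε - 1 = ε by ring, abs_of_pos hε] at h1
  nlinarith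

end IsCost

/-! ### Best responses and their first-order condition -/

section BestResponse

variable {n : ℕ} {c : ℝ → ℝ} {a s : ℝ}

theorem utility_of_pos {z : ℝ} (hz : 0 ≤ z) (hs : 0 < s) :
    utility n c z s = z / (z + s) - ((n : ℝ) - 1) / (n : ℝ) ^ 2 * c z := by
  rw [utility, if_neg (by positivity)]

theorem exists_utility_maximiser (hn : 3 ≤ n) (hc : IsCost c) (hs : 0 < s) :
    ∃ z : ℝ, 0 ≤ z ∧ ∀ y : ℝ, 0 ≤ y → utility n c y s ≤ utility n c z s := by
  have hn' : (3 : ℝ) ≤ n := by exact_mod_cast hn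
  have hα : 0 < ((n : ℝ) - 1) / (n : ℝ) ^ 2 := div_pos (by linarith) (by positivity)
  set α := ((n : ℝ) - 1) / (n : ℝ) ^ 2
  have hcont : ContinuousOn (fun z => utility n c z s) (Set.Ici 0) := by
    refine ContinuousOn.congr (f := fun z => z / (z + s) - α * c z) ?_
      fun z hz => utility_of_pos hz hs
    refine ContinuousOn.sub ?_ (continuousOn_const.mul hc.differentiableOn.continuousOn)
    refine continuousOn_id.div (continuousOn_id.add continuousOn_const) fun z hz => ?_
    have : (0 : ℝ) ≤ z := hz
    change z + s ≠ 0
    positivity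
  -- beyond this output the cost exceeds the whole prize, by convexity
  set M : ℝ := 2 + 1 / α - c 1
  have hM : 0 ≤ M := by
    have := hc.apply_one_le
    have : 0 < 1 / α := by positivity
    simp only [M]; linarith
  obtain ⟨z, hz, hmax⟩ := isCompact_Icc.exists_isMaxOn (Set.nonempty_Icc.2 hM)
    (hcont.mono (Set.Icc_subset_Ici_self))
  refine ⟨z, hz.1, fun y hy => ?_⟩
  rcases le_total y M with h | h
  · exact hmax ⟨hy, h⟩
  · have h0 : utility n c 0 s ≤ utility n c z s := hmax ⟨le_rfl, hM⟩
    refine le_trans ?_ h0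
    rw [utility_of_pos hy hs, utility_of_pos le_rfl hs, hc.zero]
    have h1 : y / (y + s) ≤ 1 := div_le_one_of_le₀ (by linarith) (by linarith)
    have h2 : 1 / α ≤ c y := by
      have := hc.tangent_le hy
      simp only [M] at h
      linarith
    have h3 : 1 ≤ α * c y := by
      rw [div_le_iff₀ hα] at h2
      linarith
    simp only [zero_div, mul_zero, sub_zero]
    linarith

theorem bestResponse_zero : bestResponse n c a 0 = a := by simp [bestResponse]

theorem bestResponse_spec (hn : 3 ≤ n) (hc : IsCost c) (hs : 0 < s) :
    0 ≤ bestResponse n c a s ∧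
      ∀ y : ℝ, 0 ≤ y → utility n c y s ≤ utility n c (bestResponse n c a s) s := by
  rw [bestResponse, if_neg hs.ne']
  exact Classical.epsilon_spec (exists_utility_maximiser hn hc hs)

/-- The first-order condition of a best response `z`: the marginal utility
`s / (z + s) ^ 2 - (n - 1) / n ^ 2 * c' z` is nonpositive, and it vanishes if `z > 0`. -/
theorem bestResponse_foc (hn : 3 ≤ n) (hc : IsCost c) (hs : 0 < s) {z : ℝ}
    (hz : bestResponse n c a s = z) :
    (n : ℝ) ^ 2 * s ≤ ((n : ℝ) - 1) * marginal c z * (z + s) ^ 2 ∧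
      (0 < z → (n : ℝ) ^ 2 * s = ((n : ℝ) - 1) * marginal c z * (z + s) ^ 2) := by
  have hn' : (3 : ℝ) ≤ n := by exact_mod_cast hn
  obtain ⟨hz0, hmax⟩ := bestResponse_spec (a := a) hn hc hs
  rw [hz] at hz0 hmax
  have hzs : z + s ≠ 0 := by positivity
  set α := ((n : ℝ) - 1) / (n : ℝ) ^ 2 with hα
  set D : ℝ := s / (z + s) ^ 2 - α * marginal c z with hD
  have hd : HasDerivWithinAt (fun y => utility n c y s) D (Set.Ici 0) z := by
    have h1 : HasDerivWithinAt (fun y => y / (y + s) - α * c y) D (Set.Ici 0) z := by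
      have h2 : HasDerivAt (fun y : ℝ => y / (y + s)) ((1 * (z + s) - z * 1) / (z + s) ^ 2) z :=
        (hasDerivAt_id z).div ((hasDerivAt_id z).add_const s) hzs
      have h3 := h2.hasDerivWithinAt.sub ((hc.hasDerivWithinAt hz0).const_mul α)
      rwa [show (1 * (z + s) - z * 1) / (z + s) ^ 2 - α * marginal c z = D by
        rw [hD]; ring_nf] at h3
    exact h1.congr (fun y hy => utility_of_pos hy hs) (utility_of_pos hz0 hs)
  have hloc : IsLocalMaxOn (fun y => utility n c y s) (Set.Ici 0) z :=
    IsMaxOn.localize fun y hy => hmax y hy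
  have key : ∀ y : ℝ, 0 ≤ y → (y - z) * D ≤ 0 := fun y hy => by
    have := hloc.hasFDerivWithinAt_nonpos hd.hasFDerivWithinAt
      (y := y - z) (sub_mem_posTangentConeAt_of_segment_subset
        ((convex_Ici (0 : ℝ)).segment_subset hz0 hy))
    simpa using this
  have hconv : (((n : ℝ) - 1) * marginal c z * (z + s) ^ 2 - (n : ℝ) ^ 2 * s) =
      -D * ((n : ℝ) ^ 2 * (z + s) ^ 2) := by
    rw [hD, hα]; field_simp; ring
  have hpos : 0 < (n : ℝ) ^ 2 * (z + s) ^ 2 := by positivity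
  have hD0 : D ≤ 0 := by
    have := key (z + 1) (by linarith)
    linarith
  refine ⟨by nlinarith, fun hzp => ?_⟩
  have hD1 : 0 ≤ D := by
    have := key 0 le_rfl
    nlinarith
  have : D = 0 := le_antisymm hD0 hD1
  rw [this] at hconv
  linarith

/-- A best response of at least `1` is at most the best response under linear cost. -/
theorem sq_le_of_one_le_bestResponse (hn : 3 ≤ n) (hc : IsCost c) (hs : 0 < s) {z : ℝ}
    (hz : bestResponse n c a s = z) (h1 : 1 ≤ z) :
    ((n : ℝ) - 1) * (z + s) ^ 2 ≤ (n : ℝ) ^ 2 * s := by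
  have hn' : (3 : ℝ) ≤ n := by exact_mod_cast hn
  rw [(bestResponse_foc hn hc hs hz).2 (by linarith)]
  have := hc.one_le_marginal h1
  have h2 : 0 ≤ ((n : ℝ) - 1) * (z + s) ^ 2 := mul_nonneg (by linarith) (sq_nonneg _)
  nlinarith

/-- A best response of at most `1` is at least the best response under linear cost. -/
theorem le_sq_of_bestResponse_le_one (hn : 3 ≤ n) (hc : IsCost c) (hs : 0 < s) {z : ℝ}
    (hz : bestResponse n c a s = z) (h1 : z ≤ 1) :
    (n : ℝ) ^ 2 * s ≤ ((n : ℝ) - 1) * (z + s) ^ 2 := by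
  have hn' : (3 : ℝ) ≤ n := by exact_mod_cast hn
  refine (bestResponse_foc hn hc hs hz).1.trans ?_
  have := hc.marginal_le_one (hz ▸ (bestResponse_spec hn hc hs).1) h1
  have h2 : 0 ≤ ((n : ℝ) - 1) * (z + s) ^ 2 := mul_nonneg (by linarith) (sq_nonneg _)
  nlinarith

/-- The best response lies on the other side of `1` than `s` does of `n - 1`, and at most half as
far away: case of small `s`. The lower bound on `s` matters: under linear cost, the best response
to `s < 1 / (n - 1)` is below `1`. -/
theorem bestResponse_bounds_of_le (hn : 3 ≤ n) (hc : IsCost c) (hs0 : 1 ≤ ((n : ℝ) - 1) * s)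
    (hs : s ≤ (n : ℝ) - 1) :
    1 ≤ bestResponse n c a s ∧ bestResponse n c a s ≤ 1 + ((n : ℝ) - 1 - s) / 2 := by
  have hn' : (3 : ℝ) ≤ n := by exact_mod_cast hn
  have hsp : 0 < s := by
    by_contra h
    nlinarith
  set z := bestResponse n c a s with hz
  have hz0 : 0 ≤ z := (bestResponse_spec hn hc hsp).1
  have hz1 : 1 ≤ z := by
    by_contra! h
    have h1 := le_sq_of_bestResponse_le_one hn hc hsp hz.symm h.le
    have h2 : (z + s) ^ 2 < (1 + s) ^ 2 := by gcongr
    have h3 : ((n : ℝ) - 1) * (z + s) ^ 2 < ((n : ℝ) - 1) * (1 + s) ^ 2 :=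
      mul_lt_mul_of_pos_left h2 (by linarith)
    nlinarith [mul_nonneg (sub_nonneg.2 hs0) (sub_nonneg.2 hs)]
  refine ⟨hz1, ?_⟩
  by_contra! h
  have h1 := sq_le_of_one_le_bestResponse hn hc hsp hz.symm hz1
  have h2 : (((n : ℝ) + 1 + s) / 2) ^ 2 < (z + s) ^ 2 := by
    gcongr
    linarith
  have h3 : ((n : ℝ) - 1) * (((n : ℝ) + 1 + s) / 2) ^ 2 < ((n : ℝ) - 1) * (z + s) ^ 2 :=
    mul_lt_mul_of_pos_left h2 (by linarith)
  have h4 : 0 ≤ (n : ℝ) * ((n : ℝ) - 1 - s) := mul_nonneg (by linarith) (by linarith)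
  have h5 : 0 ≤ ((n : ℝ) - 1) * ((n : ℝ) - 1 - s) ^ 2 := mul_nonneg (by linarith) (sq_nonneg _)
  nlinarith

/-- The best response lies on the other side of `1` than `s` does of `n - 1`, and at most half as
far away: case of large `s`. -/
theorem bestResponse_bounds_of_ge (hn : 3 ≤ n) (hc : IsCost c) (hs : (n : ℝ) - 1 ≤ s) :
    1 - (s - ((n : ℝ) - 1)) / 2 ≤ bestResponse n c a s ∧ bestResponse n c a s ≤ 1 := by
  have hn' : (3 : ℝ) ≤ n := by exact_mod_cast hn
  have hsp : 0 < s := by linarith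
  set z := bestResponse n c a s with hz
  have hz0 : 0 ≤ z := (bestResponse_spec hn hc hsp).1
  have hz1 : z ≤ 1 := by
    by_contra! h
    have h1 := sq_le_of_one_le_bestResponse hn hc hsp hz.symm h.le
    have h2 : (1 + s) ^ 2 < (z + s) ^ 2 := by gcongr
    have h3 : ((n : ℝ) - 1) * (1 + s) ^ 2 < ((n : ℝ) - 1) * (z + s) ^ 2 :=
      mul_lt_mul_of_pos_left h2 (by linarith)
    have h4 : 1 ≤ ((n : ℝ) - 1) * s := by nlinarith
    nlinarith [mul_nonneg (sub_nonneg.2 h4) (sub_nonneg.2 hs)]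
  refine ⟨?_, hz1⟩
  by_contra! h
  have h1 := le_sq_of_bestResponse_le_one hn hc hsp hz.symm hz1
  have h2 : (z + s) ^ 2 < (((n : ℝ) + 1 + s) / 2) ^ 2 := by
    gcongr
    linarith
  have h3 : ((n : ℝ) - 1) * (z + s) ^ 2 < ((n : ℝ) - 1) * (((n : ℝ) + 1 + s) / 2) ^ 2 :=
    mul_lt_mul_of_pos_left h2 (by linarith)
  obtain ⟨f, rfl⟩ : ∃ f, s = (n : ℝ) - 1 + f := ⟨s - ((n : ℝ) - 1), by ring⟩
  have hf0 : 0 ≤ f := by linarith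
  have hf2 : f ≤ 2 := by linarith
  have h4 : 0 ≤ f * (4 * n - ((n : ℝ) - 1) * f) := mul_nonneg hf0 (by nlinarith)
  nlinarith

theorem four_mul_bestResponse_le (hn : 3 ≤ n) (hc : IsCost c) (hs : 0 < s) :
    4 * ((n : ℝ) - 1) * bestResponse n c a s ≤ (n : ℝ) ^ 2 := by
  have hn' : (3 : ℝ) ≤ n := by exact_mod_cast hn
  rcases le_total (bestResponse n c a s) 1 with h | h
  · nlinarith [sq_nonneg ((n : ℝ) - 2)]
  · have h1 := sq_le_of_one_le_bestResponse hn hc hs rfl h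
    set z := bestResponse n c a s
    have h2 : ((n : ℝ) - 1) * (4 * z * s) ≤ ((n : ℝ) - 1) * (z + s) ^ 2 :=
      mul_le_mul_of_nonneg_left (by nlinarith [sq_nonneg (z - s)]) (by linarith)
    refine le_of_mul_le_mul_right ?_ hs
    linarith

/-- While the total output is below `1`, it grows at least like a square root. -/
theorem total_growth (hn : 3 ≤ n) (hc : IsCost c) (hs : 0 < s)
    (h1 : s + bestResponse n c a s < 1) : 9 * s ≤ 2 * (s + bestResponse n c a s) ^ 2 := by
  have hn' : (3 : ℝ) ≤ n := by exact_mod_cast hn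
  have h2 := le_sq_of_bestResponse_le_one hn hc hs (a := a) rfl (by linarith)
  have h3 : 9 * ((n : ℝ) - 1) ≤ 2 * (n : ℝ) ^ 2 := by nlinarith
  rw [add_comm s]
  have h4 : 0 < (n : ℝ) - 1 := by linarith
  refine le_of_mul_le_mul_left ?_ h4
  nlinarith

/-- Best responses decrease in `s` once `s` exceeds every possible best response. -/
theorem bestResponse_anti (hn : 3 ≤ n) (hc : IsCost c) {s' : ℝ}
    (hs : (n : ℝ) ^ 2 ≤ 4 * ((n : ℝ) - 1) * s) (hss : s ≤ s') :
    bestResponse n c a s' ≤ bestResponse n c a s := by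
  have hn' : (3 : ℝ) ≤ n := by exact_mod_cast hn
  have hs0 : 0 < s := by
    by_contra h
    nlinarith
  have hs0' : 0 < s' := hs0.trans_le hss
  have hB := four_mul_bestResponse_le (a := a) hn hc hs0'
  have hz0 := (bestResponse_spec (a := a) hn hc hs0).1
  set z := bestResponse n c a s with hz
  set z' := bestResponse n c a s' with hz'
  by_contra! h
  have h1 := (bestResponse_foc hn hc hs0 hz.symm).1
  have h2 := (bestResponse_foc hn hc hs0' hz'.symm).2 (by linarith)
  have hm : marginal c z ≤ marginal c z' :=
    hc.monotoneOn_marginal hz0 (hz0.trans h.le) h.le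
  have hzs : z' ≤ s := le_of_mul_le_mul_left (hB.trans hs) (by linarith)
  have hmp : 0 < marginal c z' := hc.marginal_pos _ (by linarith)
  have h3 : (n : ℝ) ^ 2 * s < ((n : ℝ) - 1) * marginal c z' * (z' + s) ^ 2 := by
    refine h1.trans_lt ?_
    have : (z + s) ^ 2 < (z' + s) ^ 2 := by gcongr
    have h5 : 0 < (n : ℝ) - 1 := by linarith
    calc ((n : ℝ) - 1) * marginal c z * (z + s) ^ 2
        ≤ ((n : ℝ) - 1) * marginal c z' * (z + s) ^ 2 := by gcongr
      _ < _ := by gcongr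
  -- `s / (z' + s) ^ 2` is decreasing in `s ≥ z'`
  have h4 : s' * (z' + s) ^ 2 ≤ s * (z' + s') ^ 2 := by
    have hzp : 0 ≤ z' := hz0.trans h.le
    have h6 : 0 ≤ (s' - s) * (s * s' - z' ^ 2) :=
      mul_nonneg (by linarith) (by nlinarith [mul_nonneg hzp (sub_nonneg.2 hzs)])
    nlinarith
  have h5 : (n : ℝ) ^ 2 * s * (z' + s') ^ 2 < (n : ℝ) ^ 2 * s' * (z' + s) ^ 2 := by
    rw [h2]
    have : 0 < (z' + s') ^ 2 := by
      have : 0 < z' + s' := by linarith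
      positivity
    calc _ < ((n : ℝ) - 1) * marginal c z' * (z' + s) ^ 2 * (z' + s') ^ 2 := by gcongr
      _ = _ := by ring
  nlinarith [sq_nonneg (n : ℝ)]

theorem bestResponse_eq_zero (hn : 3 ≤ n) (hc : IsCost c) (hm : 0 < marginal c 0)
    (hs : threshold n c ≤ s) : bestResponse n c a s = 0 := by
  have hn' : (3 : ℝ) ≤ n := by exact_mod_cast hn
  have h5 : 0 < (n : ℝ) - 1 := by linarith
  have h0 : 0 < marginal c 0 * ((n : ℝ) - 1) := mul_pos hm h5
  have hs0 : 0 < s := lt_of_lt_of_le (div_pos (by positivity) h0) hs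
  rw [threshold, div_le_iff₀ h0] at hs
  have hz0 := (bestResponse_spec (a := a) hn hc hs0).1
  by_contra h
  have hz : 0 < bestResponse n c a s := lt_of_le_of_ne hz0 (Ne.symm h)
  have h1 := (bestResponse_foc hn hc hs0 rfl).2 hz
  set z := bestResponse n c a s
  have hmz : marginal c 0 ≤ marginal c z := hc.monotoneOn_marginal (Set.mem_Ici.2 le_rfl) hz0 hz0
  have h2 : s ^ 2 < (z + s) ^ 2 := by gcongr; linarith
  have h3 : ((n : ℝ) - 1) * marginal c 0 * s ^ 2 < ((n : ℝ) - 1) * marginal c z * (z + s) ^ 2 :=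
    calc _ < ((n : ℝ) - 1) * marginal c 0 * (z + s) ^ 2 := by gcongr
      _ ≤ _ := by gcongr
  nlinarith

theorem bestResponse_pos (hn : 3 ≤ n) (hc : IsCost c) (hs0 : 0 < s)
    (hs : marginal c 0 * ((n : ℝ) - 1) * s < (n : ℝ) ^ 2) : 0 < bestResponse n c a s := by
  have hz0 := (bestResponse_spec (a := a) hn hc hs0).1
  refine lt_of_le_of_ne hz0 fun h => ?_
  have h1 := (bestResponse_foc hn hc hs0 h.symm).1
  nlinarith

end BestResponse

/-! ### Sequences of best-response moves -/

section Moves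

variable {n : ℕ} {c : ℝ → ℝ} {a : ℝ} {x y : Fin n → ℝ}

/-- The profile in which agent `i` has switched from `x i` to her best response. -/
noncomputable def move (c : ℝ → ℝ) (a : ℝ) (x : Fin n → ℝ) (i : Fin n) : Fin n → ℝ :=
  Function.update x i (bestResponse n c a (others x i))

/-- `Reaches c a x t y`: some sequence of `t` best-response moves leads from `x` to `y`. -/
inductive Reaches (c : ℝ → ℝ) (a : ℝ) (x : Fin n → ℝ) : ℕ → (Fin n → ℝ) → Prop
  | refl : Reaches c a x 0 x
  | step {t : ℕ} {y : Fin n → ℝ} (i : Fin n) :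
      Reaches c a x t y → Reaches c a x (t + 1) (move c a y i)

theorem Reaches.single (i : Fin n) : Reaches c a x 1 (move c a x i) := .step i .refl

theorem Reaches.trans {s t : ℕ} {z : Fin n → ℝ} (h : Reaches c a x s y)
    (h' : Reaches c a y t z) : Reaches c a x (s + t) z := by
  induction h' with
  | refl => exact h
  | step i _ ih => exact .step i ih

theorem dynamics_congr {i i' : ℕ → Fin n} {t : ℕ} (h : ∀ k < t, i k = i' k) :
    dynamics c a x i t = dynamics c a x i' t := by
  induction t with
  | zero => rfl
  | succ t ih =>
    simp only [dynamics, ih fun k hk => h k (by omega), h t (by omega)]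

theorem Reaches.exists_dynamics [NeZero n] {t : ℕ} (h : Reaches c a x t y) :
    ∃ i : ℕ → Fin n, dynamics c a x i t = y := by
  induction h with
  | refl => exact ⟨fun _ => 0, rfl⟩
  | @step t y j _ ih =>
    obtain ⟨i, hi⟩ := ih
    refine ⟨Function.update i t j, ?_⟩
    have : dynamics c a x (Function.update i t j) t = y := by
      rw [← hi]
      exact dynamics_congr fun k hk => Function.update_of_ne hk.ne _ _
    simp only [dynamics, this, Function.update_self, move]

theorem others_eq (x : Fin n → ℝ) (i : Fin n) : others x i = ∑ j, x j - x i := by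
  rw [others, ← Finset.add_sum_erase _ _ (Finset.mem_univ i)]
  ring

theorem others_nonneg (hx : ∀ j, 0 ≤ x j) (i : Fin n) : 0 ≤ others x i :=
  Finset.sum_nonneg fun j _ => hx j

theorem le_others (hx : ∀ j, 0 ≤ x j) {i j : Fin n} (hij : j ≠ i) : x j ≤ others x i :=
  Finset.single_le_sum (fun j _ => hx j) (Finset.mem_erase.2 ⟨hij, Finset.mem_univ j⟩)

theorem move_self (i : Fin n) : move c a x i i = bestResponse n c a (others x i) :=
  Function.update_self ..

theorem move_of_ne {i j : Fin n} (h : j ≠ i) : move c a x i j = x j :=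
  Function.update_of_ne h ..

theorem sum_move (f : ℝ → ℝ) (i : Fin n) :
    ∑ j, f (move c a x i j) =
      ∑ j, f (x j) - f (x i) + f (bestResponse n c a (others x i)) := by
  rw [← Finset.add_sum_erase _ _ (Finset.mem_univ i),
    ← Finset.add_sum_erase (a := i) Finset.univ (fun j => f (x j)) (Finset.mem_univ i), move_self]
  rw [Finset.sum_congr rfl fun j hj => by rw [move_of_ne (Finset.ne_of_mem_erase hj)]]
  ring

theorem total_move (i : Fin n) :
    ∑ j, move c a x i j = others x i + bestResponse n c a (others x i) := by
  rw [sum_move (fun z => z), others_eq]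

/-- `z` lies between `0` and `n ^ 2 / (4 * (n - 1))`, an upper bound for all best responses. -/
def Moderate (n : ℕ) (z : ℝ) : Prop := 0 ≤ z ∧ 4 * ((n : ℝ) - 1) * z ≤ (n : ℝ) ^ 2

theorem moderate_bestResponse (hn : 3 ≤ n) (hc : IsCost c) (ha : 0 < a) (ha1 : a < 1) {s : ℝ}
    (hs : 0 ≤ s) : Moderate n (bestResponse n c a s) := by
  have hn' : (3 : ℝ) ≤ n := by exact_mod_cast hn
  rcases hs.eq_or_lt with rfl | h
  · rw [bestResponse_zero]
    exact ⟨ha.le, by nlinarith [sq_nonneg ((n : ℝ) - 2)]⟩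
  · exact ⟨(bestResponse_spec hn hc h).1, four_mul_bestResponse_le hn hc h⟩

theorem moderate_move (hn : 3 ≤ n) (hc : IsCost c) (ha : 0 < a) (ha1 : a < 1)
    (hx : ∀ j, Moderate n (x j)) (i j : Fin n) : Moderate n (move c a x i j) := by
  by_cases h : j = i
  · subst h
    rw [move_self]
    exact moderate_bestResponse hn hc ha ha1 (others_nonneg (fun j => (hx j).1) _)
  · rw [move_of_ne h]
    exact hx j

theorem nonneg_move (hn : 3 ≤ n) (hc : IsCost c) (ha : 0 < a) (ha1 : a < 1)
    (hx : ∀ j, 0 ≤ x j) (i j : Fin n) : 0 ≤ move c a x i j := by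
  by_cases h : j = i
  · subst h
    rw [move_self]
    exact (moderate_bestResponse hn hc ha ha1 (others_nonneg hx _)).1
  · rw [move_of_ne h]
    exact hx j

end Moves

/-! ### Linear convergence near the equilibrium -/

section Contraction

variable {n : ℕ} {c : ℝ → ℝ} {a : ℝ} {x : Fin n → ℝ}

/-- Sum of the amounts by which outputs exceed the equilibrium output `1`. -/
def excess (x : Fin n → ℝ) : ℝ := ∑ j, max (x j - 1) 0

/-- Sum of the amounts by which outputs fall short of the equilibrium output `1`. -/
def deficit (x : Fin n → ℝ) : ℝ := ∑ j, max (1 - x j) 0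

theorem excess_sub_deficit (x : Fin n → ℝ) : excess x - deficit x = ∑ j, x j - n := by
  have h : ∀ z : ℝ, max (z - 1) 0 - max (1 - z) 0 = z - 1 := fun z => by
    rcases le_total z 1 with h | h
    · rw [max_eq_right (by linarith), max_eq_left (by linarith)]; ring
    · rw [max_eq_left (by linarith), max_eq_right (by linarith)]; ring
  rw [excess, deficit, ← Finset.sum_sub_distrib, Finset.sum_congr rfl fun j _ => h (x j)]
  simp

theorem excess_nonneg (x : Fin n → ℝ) : 0 ≤ excess x :=
  Finset.sum_nonneg fun _ _ => le_max_right _ _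

theorem deficit_nonneg (x : Fin n → ℝ) : 0 ≤ deficit x :=
  Finset.sum_nonneg fun _ _ => le_max_right _ _

/-- If the total output is at least `n`, the move of an agent with maximal output shrinks the
excess by a factor, and it either keeps the excess dominant or leaves the deficit unchanged. -/
theorem exists_move_excess (hn : 3 ≤ n) (hc : IsCost c) (ha : 0 < a) (ha1 : a < 1)
    (hx : ∀ j, Moderate n (x j)) (hT : deficit x ≤ excess x) :
    ∃ i, 1 ≤ ∑ j, move c a x i j ∧
      excess (move c a x i) ≤ (1 - 1 / (2 * n)) * excess x ∧
      (deficit (move c a x i) ≤ excess (move c a x i) ∨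
        deficit (move c a x i) = deficit x ∧ excess (move c a x i) ≤ deficit (move c a x i)) := by
  have hn' : (3 : ℝ) ≤ n := by exact_mod_cast hn
  have : NeZero n := ⟨by omega⟩
  obtain ⟨i, -, hi⟩ := Finset.exists_max_image Finset.univ x Finset.univ_nonempty
  have hsub := excess_sub_deficit x
  have hp : 0 ≤ x i - 1 := by
    have h1 : ∑ j, x j ≤ ∑ _j : Fin n, x i := Finset.sum_le_sum fun j hj => hi j hj
    simp at h1
    by_contra! h
    nlinarith
  have hP : excess x ≤ n * (x i - 1) := by
    have h1 : excess x ≤ ∑ _j : Fin n, (x i - 1) :=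
      Finset.sum_le_sum fun j hj => max_le (by linarith [hi j hj]) hp
    simp only [Finset.sum_const, Finset.card_univ, Fintype.card_fin, nsmul_eq_mul] at h1
    exact h1
  have hpP : excess x / (2 * n) ≤ (x i - 1) / 2 := by
    rw [div_le_div_iff₀ (by positivity) (by positivity)]
    linarith
  have hgoal : (1 - 1 / (2 * (n : ℝ))) * excess x = excess x - excess x / (2 * n) := by ring
  rw [hgoal]
  have hE : excess (move c a x i) = excess x - (x i - 1) +
      max (bestResponse n c a (others x i) - 1) 0 := by
    rw [excess, sum_move (fun z => max (z - 1) 0), excess, max_eq_left hp]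
  have hD : deficit (move c a x i) = deficit x +
      max (1 - bestResponse n c a (others x i)) 0 := by
    rw [deficit, sum_move (fun z => max (1 - z) 0), deficit,
      max_eq_right (a := 1 - x i) (by linarith), sub_zero]
  have hs := others_eq x i
  have hsub' := excess_sub_deficit (move c a x i)
  have htot := total_move (c := c) (a := a) (x := x) i
  refine ⟨i, ?_⟩
  rcases le_total ((n : ℝ) - 1) (others x i) with h | h
  · obtain ⟨h1, h2⟩ := bestResponse_bounds_of_ge (a := a) hn hc h
    rw [max_eq_right (by linarith)] at hE
    rw [max_eq_left (by linarith)] at hD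
    exact ⟨by linarith, by linarith, Or.inl (by linarith)⟩
  · have hB := (hx i).2
    have h0 : 1 ≤ ((n : ℝ) - 1) * others x i := by
      have : (n : ℝ) - x i ≤ others x i := by linarith
      nlinarith
    obtain ⟨h1, h2⟩ := bestResponse_bounds_of_le (a := a) hn hc h0 h
    have hs0 : 0 ≤ others x i := others_nonneg (fun j => (hx j).1) i
    rw [max_eq_left (by linarith)] at hE
    rw [max_eq_right (by linarith)] at hD
    exact ⟨by linarith, by linarith, Or.inr ⟨by linarith, by linarith⟩⟩

/-- If the total output is at most `n`, the move of an agent with minimal output shrinks the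
deficit by a factor, and it either keeps the deficit dominant or leaves the excess unchanged. -/
theorem exists_move_deficit (hn : 3 ≤ n) (hc : IsCost c)
    (hS : 1 ≤ ∑ j, x j) (hT : excess x ≤ deficit x) :
    ∃ i, 1 ≤ ∑ j, move c a x i j ∧
      deficit (move c a x i) ≤ (1 - 1 / (2 * n)) * deficit x ∧
      (excess (move c a x i) ≤ deficit (move c a x i) ∨
        excess (move c a x i) = excess x ∧ deficit (move c a x i) ≤ excess (move c a x i)) := by
  have hn' : (3 : ℝ) ≤ n := by exact_mod_cast hn
  have : NeZero n := ⟨by omega⟩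
  obtain ⟨i, -, hi⟩ := Finset.exists_min_image Finset.univ x Finset.univ_nonempty
  have hsub := excess_sub_deficit x
  have hmean : n * x i ≤ ∑ j, x j := by
    have h1 : ∑ _j : Fin n, x i ≤ ∑ j, x j := Finset.sum_le_sum fun j hj => hi j hj
    simpa using h1
  have hp : 0 ≤ 1 - x i := by
    by_contra! h
    nlinarith
  have hP : deficit x ≤ n * (1 - x i) := by
    have h1 : deficit x ≤ ∑ _j : Fin n, (1 - x i) :=
      Finset.sum_le_sum fun j hj => max_le (by linarith [hi j hj]) hp
    simp only [Finset.sum_const, Finset.card_univ, Fintype.card_fin, nsmul_eq_mul] at h1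
    exact h1
  have hpP : deficit x / (2 * n) ≤ (1 - x i) / 2 := by
    rw [div_le_div_iff₀ (by positivity) (by positivity)]
    linarith
  have hgoal : (1 - 1 / (2 * (n : ℝ))) * deficit x = deficit x - deficit x / (2 * n) := by ring
  rw [hgoal]
  have hE : excess (move c a x i) = excess x +
      max (bestResponse n c a (others x i) - 1) 0 := by
    rw [excess, sum_move (fun z => max (z - 1) 0), excess,
      max_eq_right (a := x i - 1) (by linarith), sub_zero]
  have hD : deficit (move c a x i) = deficit x - (1 - x i) +
      max (1 - bestResponse n c a (others x i)) 0 := by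
    rw [deficit, sum_move (fun z => max (1 - z) 0), deficit, max_eq_left hp]
  have hs := others_eq x i
  have hsub' := excess_sub_deficit (move c a x i)
  have htot := total_move (c := c) (a := a) (x := x) i
  refine ⟨i, ?_⟩
  rcases le_total ((n : ℝ) - 1) (others x i) with h | h
  · obtain ⟨h1, h2⟩ := bestResponse_bounds_of_ge (a := a) hn hc h
    rw [max_eq_right (by linarith)] at hE
    rw [max_eq_left (by linarith)] at hD
    exact ⟨by linarith, by linarith, Or.inr ⟨by linarith, by linarith⟩⟩
  · have h0 : 1 ≤ ((n : ℝ) - 1) * others x i := by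
      have : ((n : ℝ) - 1) * ∑ j, x j ≤ n * others x i := by nlinarith
      have : ((n : ℝ) - 1) ≤ n * others x i := by nlinarith
      nlinarith
    obtain ⟨h1, h2⟩ := bestResponse_bounds_of_le (a := a) hn hc h0 h
    rw [max_eq_left (by linarith)] at hE
    rw [max_eq_right (by linarith)] at hD
    exact ⟨by linarith, by linarith, Or.inl (by linarith)⟩

/-- Two moves suffice to shrink `max (excess x) (deficit x)` by a factor: if the first one does
not, it makes the other side dominant, and the second one shrinks that side. -/
theorem exists_contraction (hn : 3 ≤ n) (hc : IsCost c) (ha : 0 < a) (ha1 : a < 1)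
    (hx : ∀ j, Moderate n (x j)) (hS : 1 ≤ ∑ j, x j) :
    ∃ (t : ℕ) (y : Fin n → ℝ), t ≤ 2 ∧ Reaches c a x t y ∧ (∀ j, Moderate n (y j)) ∧
      1 ≤ ∑ j, y j ∧
      max (excess y) (deficit y) ≤ (1 - 1 / (2 * n)) * max (excess x) (deficit x) := by
  have hn' : (3 : ℝ) ≤ n := by exact_mod_cast hn
  have hr : (0 : ℝ) ≤ 1 - 1 / (2 * n) := by
    rw [sub_nonneg, div_le_one (by positivity)]
    linarith
  rcases le_total (deficit x) (excess x) with h | h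
  · rw [max_eq_left h]
    obtain ⟨i, h1, h2, h3⟩ := exists_move_excess hn hc ha ha1 hx h
    have hm := moderate_move hn hc ha ha1 hx i
    rcases h3 with h3 | ⟨h3, h4⟩
    · exact ⟨1, _, by omega, .single i, hm, h1, max_le h2 (h3.trans h2)⟩
    · obtain ⟨k, h5, h6, h7⟩ := exists_move_deficit (a := a) hn hc h1 h4
      have h8 := h6.trans (mul_le_mul_of_nonneg_left (h3.trans_le h) hr)
      refine ⟨2, _, le_rfl, .step k (.single i), moderate_move hn hc ha ha1 hm k, h5,
        max_le ?_ h8⟩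
      rcases h7 with h7 | ⟨h7, -⟩
      · exact h7.trans h8
      · exact h7.trans_le h2
  · rw [max_eq_right h]
    obtain ⟨i, h1, h2, h3⟩ := exists_move_deficit (a := a) hn hc hS h
    have hm := moderate_move hn hc ha ha1 hx i
    rcases h3 with h3 | ⟨h3, h4⟩
    · exact ⟨1, _, by omega, .single i, hm, h1, max_le (h3.trans h2) h2⟩
    · obtain ⟨k, h5, h6, h7⟩ := exists_move_excess hn hc ha ha1 hm h4
      have h8 := h6.trans (mul_le_mul_of_nonneg_left (h3.trans_le h) hr)
      refine ⟨2, _, le_rfl, .step k (.single i), moderate_move hn hc ha ha1 hm k, h5,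
        max_le h8 ?_⟩
      rcases h7 with h7 | ⟨h7, -⟩
      · exact h7.trans h8
      · exact h7.trans_le h2

theorem exists_iterated_contraction (hn : 3 ≤ n) (hc : IsCost c) (ha : 0 < a) (ha1 : a < 1)
    (hx : ∀ j, Moderate n (x j)) (hS : 1 ≤ ∑ j, x j) (k : ℕ) :
    ∃ (t : ℕ) (y : Fin n → ℝ), t ≤ 2 * k ∧ Reaches c a x t y ∧ (∀ j, Moderate n (y j)) ∧
      1 ≤ ∑ j, y j ∧
      max (excess y) (deficit y) ≤ (1 - 1 / (2 * n)) ^ k * max (excess x) (deficit x) := by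
  have hn' : (3 : ℝ) ≤ n := by exact_mod_cast hn
  have hr : (0 : ℝ) ≤ 1 - 1 / (2 * n) := by
    rw [sub_nonneg, div_le_one (by positivity)]
    linarith
  induction k with
  | zero => exact ⟨0, x, by omega, .refl, hx, hS, by simp⟩
  | succ k ih =>
    obtain ⟨t, y, ht, hy, hym, hyS, hyV⟩ := ih
    obtain ⟨t', z, ht', hz, hzm, hzS, hzV⟩ := exists_contraction hn hc ha ha1 hym hyS
    refine ⟨t + t', z, by omega, hy.trans hz, hzm, hzS, hzV.trans ?_⟩
    rw [pow_succ', mul_assoc]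
    exact mul_le_mul_of_nonneg_left hyV hr

theorem max_excess_deficit_le (hn : 3 ≤ n) (hx : ∀ j, Moderate n (x j)) :
    max (excess x) (deficit x) ≤ (n : ℝ) ^ 2 := by
  have hn' : (3 : ℝ) ≤ n := by exact_mod_cast hn
  have h1 : excess x ≤ ∑ _j : Fin n, (n : ℝ) := Finset.sum_le_sum fun j _ =>
    max_le (by nlinarith [(hx j).1, (hx j).2]) (by linarith)
  have h2 : deficit x ≤ ∑ _j : Fin n, (n : ℝ) := Finset.sum_le_sum fun j _ =>
    max_le (by linarith [(hx j).1]) (by linarith)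
  simp only [Finset.sum_const, Finset.card_univ, Fintype.card_fin, nsmul_eq_mul] at h1 h2
  rw [sq]
  exact max_le h1 h2

theorem exists_reaches_near (hn : 3 ≤ n) (hc : IsCost c) (ha : 0 < a) (ha1 : a < 1)
    (hx : ∀ j, Moderate n (x j)) (hS : 1 ≤ ∑ j, x j) {δ : ℝ} (hδ : 0 < δ) (hδ1 : δ ≤ 1) :
    ∃ (t : ℕ) (y : Fin n → ℝ), (t : ℝ) ≤ 4 * n * Real.log ((n : ℝ) ^ 2 / δ) + 2 ∧
      Reaches c a x t y ∧ max (excess y) (deficit y) ≤ δ := by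
  have hn' : (3 : ℝ) ≤ n := by exact_mod_cast hn
  have hL : 0 ≤ Real.log ((n : ℝ) ^ 2 / δ) := by
    refine Real.log_nonneg ((one_le_div hδ).2 ?_)
    nlinarith
  set L := Real.log ((n : ℝ) ^ 2 / δ) with hLdef
  set k := ⌈2 * (n : ℝ) * L⌉₊
  obtain ⟨t, y, ht, hy, -, -, hV⟩ := exists_iterated_contraction hn hc ha ha1 hx hS k
  refine ⟨t, y, ?_, hy, hV.trans ?_⟩
  · have h1 : (k : ℝ) < 2 * n * L + 1 := Nat.ceil_lt_add_one (by positivity)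
    have h2 : (t : ℝ) ≤ 2 * k := by exact_mod_cast ht
    linarith
  · have hr : (0 : ℝ) ≤ 1 - 1 / (2 * n) := by
      rw [sub_nonneg, div_le_one (by positivity)]
      linarith
    have h1 : (1 - 1 / (2 * (n : ℝ))) ^ k ≤ Real.exp (-L) := by
      calc (1 - 1 / (2 * (n : ℝ))) ^ k ≤ Real.exp (-(1 / (2 * n))) ^ k :=
            pow_le_pow_left₀ hr (Real.one_sub_le_exp_neg _) k
        _ = Real.exp (k * -(1 / (2 * n))) := (Real.exp_nat_mul _ _).symm
        _ ≤ Real.exp (-L) := by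
          refine Real.exp_le_exp.2 ?_
          have h2 : 2 * (n : ℝ) * L ≤ k := Nat.le_ceil _
          have h3 : L ≤ k / (2 * n) := by
            rw [le_div_iff₀ (by positivity)]
            linarith
          calc (k : ℝ) * -(1 / (2 * n)) = -(k / (2 * n)) := by ring
            _ ≤ -L := neg_le_neg h3
    have h4 : Real.exp (-L) = δ / (n : ℝ) ^ 2 := by
      rw [Real.exp_neg, Real.exp_log (by positivity), inv_div]
    rw [h4] at h1
    calc _ ≤ δ / (n : ℝ) ^ 2 * (n : ℝ) ^ 2 :=
          mul_le_mul h1 (max_excess_deficit_le hn hx) (le_max_of_le_left (excess_nonneg x))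
            (by positivity)
      _ = δ := by field_simp

end Contraction

/-! ### Profiles near the equilibrium are approximate equilibria -/

section UpperBound

variable {n : ℕ} {c : ℝ → ℝ} {a : ℝ} {x : Fin n → ℝ}

theorem isApproxEquilibrium_of_near (hn : 3 ≤ n) (hc : IsCost c) {ε K δ : ℝ} (hε : 0 < ε)
    (hε1 : ε < 1) (hK : LipschitzNearOne c K ε) (hδ : δ * (6 * (n : ℝ) ^ 2 * K) ≤ ε)
    (hx : max (excess x) (deficit x) ≤ δ) : IsApproxEquilibrium c ε x := by
  have hn' : (3 : ℝ) ≤ n := by exact_mod_cast hn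
  have hK1 := hc.one_le_lipschitz hε hK
  have hE : excess x ≤ δ := (le_max_left _ _).trans hx
  have hD : deficit x ≤ δ := (le_max_right _ _).trans hx
  have hδ0 : 0 ≤ δ := (excess_nonneg x).trans hE
  have hn2 : (9 : ℝ) ≤ (n : ℝ) ^ 2 := by nlinarith
  have hδK : δ ≤ δ * K := le_mul_of_one_le_right hδ0 hK1
  have hδKn : δ * K * 9 ≤ δ * K * (n : ℝ) ^ 2 :=
    mul_le_mul_of_nonneg_left hn2 (by positivity)
  have hδ1 : 54 * δ ≤ ε := by linarith
  have hsub := excess_sub_deficit x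
  have hE0 := excess_nonneg x
  have hD0 := deficit_nonneg x
  intro i y hy
  have hxi1 : x i ≤ 1 + δ := by
    have h1 : max (x i - 1) 0 ≤ excess x :=
      Finset.single_le_sum (f := fun j => max (x j - 1) 0) (fun j _ => le_max_right _ _)
        (Finset.mem_univ i)
    linarith [le_max_left (x i - 1) 0]
  have hxi2 : 1 - δ ≤ x i := by
    have h1 : max (1 - x i) 0 ≤ deficit x :=
      Finset.single_le_sum (f := fun j => max (1 - x j) 0) (fun j _ => le_max_right _ _)
        (Finset.mem_univ i)
    linarith [le_max_left (1 - x i) 0]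
  have hs := others_eq x i
  set s := others x i
  have hs1 : s ≤ n - 1 + 2 * δ := by linarith
  have hs2 : n - 1 - 2 * δ ≤ s := by linarith
  have hs0 : 1 < s := by linarith
  obtain ⟨hz0, hmax⟩ := bestResponse_spec (a := 0) hn hc (s := s) (by linarith)
  have hz : 1 - δ ≤ bestResponse n c 0 s ∧ bestResponse n c 0 s ≤ 1 + δ := by
    rcases le_total s ((n : ℝ) - 1) with h | h
    · obtain ⟨h1, h2⟩ := bestResponse_bounds_of_le (a := 0) hn hc (by nlinarith) h
      exact ⟨by linarith, by linarith⟩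
    · obtain ⟨h1, h2⟩ := bestResponse_bounds_of_ge (a := 0) hn hc h
      exact ⟨by linarith, by linarith⟩
  set z := bestResponse n c 0 s
  have hxz : |z - x i| ≤ 2 * δ := abs_le.2 ⟨by linarith, by linarith⟩
  have hα : ((n : ℝ) - 1) / (n : ℝ) ^ 2 ≤ 1 := by
    rw [div_le_one (by positivity)]
    nlinarith
  have hα0 : 0 ≤ ((n : ℝ) - 1) / (n : ℝ) ^ 2 := div_nonneg (by linarith) (by positivity)
  have hxi0 : 0 ≤ x i := by linarith
  have hx1 : 1 ≤ x i + s := by linarith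
  have hz1 : 1 ≤ z + s := by linarith
  have hshare : z / (z + s) - x i / (x i + s) ≤ 2 * δ := by
    rw [div_sub_div _ _ (by linarith) (by linarith), div_le_iff₀ (by positivity)]
    have h1 : z * (x i + s) - (z + s) * x i ≤ 2 * δ * s := by
      have h3 := mul_le_mul_of_nonneg_right (abs_le.1 hxz).2 (by linarith : 0 ≤ s)
      linarith
    have h2 : s ≤ (z + s) * (x i + s) := by
      have h3 : (z + s) * 1 ≤ (z + s) * (x i + s) := mul_le_mul_of_nonneg_left hx1 (by linarith)
      linarith
    have h3 := mul_le_mul_of_nonneg_left h2 (by linarith : 0 ≤ 2 * δ)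
    linarith
  have hcost : ((n : ℝ) - 1) / (n : ℝ) ^ 2 * (c (x i) - c z) ≤ 2 * δ * K := by
    have h1 := hK z ⟨by linarith, by linarith⟩ (x i) ⟨by linarith, by linarith⟩
    have h2 : c (x i) - c z ≤ K * (2 * δ) := by
      have h3 := (abs_le.1 h1).1
      have h4 : K * |z - x i| ≤ K * (2 * δ) := mul_le_mul_of_nonneg_left hxz (by linarith)
      linarith
    have h5 : 0 ≤ K * (2 * δ) := by positivity
    have h6 := mul_le_mul_of_nonneg_left h2 hα0
    have h7 := mul_le_mul_of_nonneg_right hα h5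
    linarith
  have hloss : utility n c z s - utility n c (x i) s ≤ 4 * δ * K := by
    rw [utility_of_pos hz0 (by linarith), utility_of_pos hxi0 (by linarith)]
    linarith
  -- the prize share `1 / (1 + s)` at output `1` exceeds the cost by almost `1 / n ^ 2`
  have hval : 2 / 3 / (n : ℝ) ^ 2 ≤ utility n c z s := by
    refine le_trans ?_ (hmax 1 zero_le_one)
    rw [utility_of_pos zero_le_one (by linarith)]
    have h1 := mul_le_mul_of_nonneg_left hc.apply_one_le hα0
    have h2 : ((n : ℝ) - 1 / 3) / (n : ℝ) ^ 2 ≤ 1 / (1 + s) := by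
      rw [div_le_div_iff₀ (by positivity) (by positivity)]
      have h3 : δ * (n : ℝ) ≤ 1 / 18 := by
        have : δ * (n : ℝ) * 3 ≤ δ * (n : ℝ) * n := mul_le_mul_of_nonneg_left hn' (by positivity)
        have : δ * (n : ℝ) ^ 2 * 1 ≤ δ * (n : ℝ) ^ 2 * K :=
          mul_le_mul_of_nonneg_left hK1 (by positivity)
        linarith
      have h4 : ((n : ℝ) - 1 / 3) * (1 + s) ≤ (n - 1 / 3) * (n + 2 * δ) :=
        mul_le_mul_of_nonneg_left (by linarith) (by linarith)
      linarith
    have h4 : 2 / 3 / (n : ℝ) ^ 2 =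
        ((n : ℝ) - 1 / 3) / (n : ℝ) ^ 2 - ((n : ℝ) - 1) / (n : ℝ) ^ 2 * 1 := by
      field_simp; ring
    linarith
  have hfin : 4 * δ * K ≤ ε * (2 / 3 / (n : ℝ) ^ 2) := by
    rw [mul_div_assoc', le_div_iff₀ (by positivity)]
    linarith
  have h1 := mul_le_mul_of_nonneg_left (hmax y hy) (by linarith : 0 ≤ 1 - ε)
  have h2 := mul_le_mul_of_nonneg_left hval hε.le
  linarith

/-! ### Growth of a small total output -/

theorem exists_move_growth (hn : 3 ≤ n) (hc : IsCost c)
    (hS : 0 < ∑ j, x j) :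
    ∃ i, 1 ≤ ∑ j, move c a x i j ∨ 3 * ∑ j, x j ≤ (∑ j, move c a x i j) ^ 2 := by
  have hn' : (3 : ℝ) ≤ n := by exact_mod_cast hn
  have : NeZero n := ⟨by omega⟩
  obtain ⟨i, -, hi⟩ := Finset.exists_min_image Finset.univ x Finset.univ_nonempty
  have hmean : n * x i ≤ ∑ j, x j := by
    have h1 : ∑ _j : Fin n, x i ≤ ∑ j, x j := Finset.sum_le_sum fun j hj => hi j hj
    simpa using h1
  refine ⟨i, ?_⟩
  rw [total_move]
  by_contra! h
  have hs : 2 * ∑ j, x j ≤ 3 * others x i := by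
    rw [others_eq]
    rcases le_total (x i) 0 with h0 | h0 <;> nlinarith
  have := total_growth (a := a) hn hc (by linarith) h.1
  linarith

theorem exists_reaches_one (hn : 3 ≤ n) (hc : IsCost c) (ha : 0 < a) (ha1 : a < 1)
    (hx : ∀ j, Moderate n (x j)) (k : ℕ) (hS : Real.exp (-2 ^ k) ≤ ∑ j, x j) :
    ∃ (t : ℕ) (y : Fin n → ℝ), t ≤ k + 1 ∧ Reaches c a x t y ∧ (∀ j, Moderate n (y j)) ∧
      1 ≤ ∑ j, y j := by
  induction k generalizing x with
  | zero =>
    have hpos := (Real.exp_pos _).trans_le hS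
    obtain ⟨i, h⟩ := exists_move_growth (a := a) hn hc hpos
    have hm := moderate_move hn hc ha ha1 hx i
    refine ⟨1, _, le_rfl, .single i, hm, ?_⟩
    rcases h with h | h
    · exact h
    · have h1 : 0 ≤ ∑ j, move c a x i j := Finset.sum_nonneg fun j _ => (hm j).1
      have h2 : 1 ≤ 3 * Real.exp (-2 ^ 0) := by
        rw [pow_zero, Real.exp_neg, ← div_eq_mul_inv, one_le_div (Real.exp_pos _)]
        exact Real.exp_one_lt_d9.le.trans (by norm_num)
      nlinarith
  | succ k ih =>
    have hpos := (Real.exp_pos _).trans_le hS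
    obtain ⟨i, h⟩ := exists_move_growth (a := a) hn hc hpos
    have hm := moderate_move hn hc ha ha1 hx i
    rcases h with h | h
    · exact ⟨1, _, by omega, .single i, hm, h⟩
    · have h1 : 0 ≤ ∑ j, move c a x i j := Finset.sum_nonneg fun j _ => (hm j).1
      have h2 : Real.exp (-2 ^ k) ≤ ∑ j, move c a x i j := by
        refine le_of_sq_le_sq ?_ h1
        rw [← Real.exp_nat_mul]
        have : ((2 : ℕ) : ℝ) * -2 ^ k = -2 ^ (k + 1) := by push_cast; ring
        rw [this]
        linarith
      obtain ⟨t, y, ht, hy, hym, hyS⟩ := ih hm h2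
      exact ⟨1 + t, y, by omega, (Reaches.single i).trans hy, hym, hyS⟩

/-! ### The initial sweep over large outputs -/

/-- Letting the agents of a finite set `A` move once each. The moved agents end up with best
responses to outputs that are at least the output of any given agent `g` outside `A`. -/
theorem exists_sweep (hn : 3 ≤ n) (hc : IsCost c) (ha : 0 < a) (ha1 : a < 1)
    (hx : ∀ j, 0 ≤ x j) (A : Finset (Fin n)) :
    ∃ y : Fin n → ℝ, Reaches c a x A.card y ∧ (∀ j, 0 ≤ y j) ∧ (∀ j ∉ A, y j = x j) ∧
      (∀ j ∈ A, Moderate n (y j)) ∧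
      ∀ g ∉ A, ∀ j ∈ A, ∃ s, x g ≤ s ∧ y j = bestResponse n c a s := by
  induction A using Finset.induction_on with
  | empty => exact ⟨x, .refl, hx, by simp, by simp, by simp⟩
  | insert i A hi ih =>
    obtain ⟨y, hy, hy0, hyA, hym, hyg⟩ := ih
    refine ⟨move c a y i, ?_, nonneg_move hn hc ha ha1 hy0 i, fun j hj => ?_, fun j hj => ?_,
      fun g hg j hj => ?_⟩
    · rw [Finset.card_insert_of_notMem hi]
      exact .step i hy
    · rw [Finset.mem_insert, not_or] at hj
      rw [move_of_ne hj.1, hyA j hj.2]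
    · by_cases h : j = i
      · subst h
        rw [move_self]
        exact moderate_bestResponse hn hc ha ha1 (others_nonneg hy0 _)
      · rw [move_of_ne h]
        exact hym j (Finset.mem_of_mem_insert_of_ne hj h)
    · rw [Finset.mem_insert, not_or] at hg
      by_cases h : j = i
      · subst h
        exact ⟨_, hyA g hg.2 ▸ le_others hy0 hg.1, move_self j⟩
      · rw [move_of_ne h]
        exact hyg g hg.2 j (Finset.mem_of_mem_insert_of_ne hj h)

/-- The infimum defining `gammaOf` is a true lower bound, as its set is bounded below by `0`. -/
theorem gammaOf_le (hn : 3 ≤ n) (hc : IsCost c) (ha : 0 < a) (ha1 : a < 1) (hx : ∀ j, 0 ≤ x j)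
    {v : ℝ} (hv : v ∈ {a} ∪ {y | ∃ j : Fin n, 0 < x j ∧ y = x j} ∪ responseSet c a x) :
    gammaOf c a x ≤ v := by
  refine csInf_le ⟨0, ?_⟩ hv
  have hb : ∀ s, 0 ≤ s → 0 ≤ bestResponse n c a s := fun s hs =>
    (moderate_bestResponse hn hc ha ha1 hs).1
  rintro w ((rfl | ⟨j, hj, rfl⟩) | (⟨-, j, rfl⟩ | ⟨-, j, hj, rfl⟩))
  · exact ha.le
  · exact hj.le
  · exact hb _ (by linarith [hx j])
  · exact le_min (by linarith) (hb _ (by linarith [hx j]))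

theorem finite_gammaSet (x : Fin n → ℝ) :
    ({a} ∪ {y | ∃ j : Fin n, 0 < x j ∧ y = x j} ∪ responseSet c a x).Finite := by
  refine ((Set.finite_singleton a).union ?_).union ?_
  · exact (Set.finite_range x).subset fun y ⟨j, _, h⟩ => ⟨j, h.symm⟩
  · refine ((Set.finite_range fun j => bestResponse n c a (x j + 1)).union
      (Set.finite_range fun j => min ((threshold n c - x j) / 2)
        (bestResponse n c a ((threshold n c + x j) / 2)))).subset ?_
    rintro y (⟨-, j, rfl⟩ | ⟨-, j, -, rfl⟩)
    · exact Or.inl ⟨j, rfl⟩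
    · exact Or.inr ⟨j, rfl⟩

theorem gammaOf_pos (hn : 3 ≤ n) (hc : IsCost c) (ha : 0 < a) (hx : ∀ j, 0 ≤ x j) :
    0 < gammaOf c a x := by
  have hn' : (3 : ℝ) ≤ n := by exact_mod_cast hn
  have hmem := Set.Nonempty.csInf_mem ⟨a, Or.inl (Or.inl rfl)⟩ (finite_gammaSet (c := c) (a := a) x)
  change gammaOf c a x ∈ _ at hmem
  rcases hmem with (h | ⟨j, hj, h⟩) | (⟨h0, j, h⟩ | ⟨h0, j, hj, h⟩)
  · rw [Set.mem_singleton_iff.1 h]; exact ha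
  · rw [h]; exact hj
  · rw [h]
    refine bestResponse_pos hn hc (by linarith [hx j]) ?_
    rw [h0, zero_mul, zero_mul]
    positivity
  · rw [h]
    have h5 : 0 < marginal c 0 * ((n : ℝ) - 1) := mul_pos h0 (by linarith)
    refine lt_min (by linarith) (bestResponse_pos hn hc (by linarith [hx j]) ?_)
    rw [mul_comm, ← lt_div_iff₀ h5]
    change _ < threshold n c
    linarith

/-- If the last agent `g` to be swept is large, the agents swept before leave a total output `r`
such that either `r` or the best response to `x g + r` is at least `gammaOf c a x`. -/
theorem gammaOf_le_add_bestResponse (hn : 3 ≤ n) (hc : IsCost c) (ha : 0 < a) (ha1 : a < 1)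
    (hx : ∀ j, 0 ≤ x j) {g : Fin n} (hg : (n : ℝ) ^ 2 ≤ 4 * ((n : ℝ) - 1) * x g)
    (hκ : 0 < marginal c 0 → x g < threshold n c) {r : ℝ} (hr : 0 ≤ r) :
    gammaOf c a x ≤ r + bestResponse n c a (x g + r) := by
  have hn' : (3 : ℝ) ≤ n := by exact_mod_cast hn
  have hb : 0 ≤ bestResponse n c a (x g + r) :=
    (moderate_bestResponse hn hc ha ha1 (by linarith [hx g])).1
  have hg' : (n : ℝ) ^ 2 ≤ 4 * ((n : ℝ) - 1) * (x g + r) := by nlinarith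
  have hm0 := hc.marginal_zero_nonneg
  rcases hm0.eq_or_lt with h0 | h0
  · have hγ : gammaOf c a x ≤ bestResponse n c a (x g + 1) :=
      gammaOf_le hn hc ha ha1 hx (Or.inr (Or.inl ⟨h0.symm, g, rfl⟩))
    rcases le_total r 1 with h | h
    · have := bestResponse_anti (a := a) hn hc hg' (by linarith : x g + r ≤ x g + 1)
      linarith
    · have := gammaOf_le hn hc ha ha1 hx (Or.inl (Or.inl rfl))
      linarith
  · have hγ := gammaOf_le hn hc ha ha1 hx (Or.inr (Or.inr ⟨h0, g, hκ h0, rfl⟩))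
    rcases le_total r ((threshold n c - x g) / 2) with h | h
    · have := bestResponse_anti (a := a) hn hc hg'
        (by linarith : x g + r ≤ (threshold n c + x g) / 2)
      linarith [hγ.trans (min_le_right _ _)]
    · linarith [hγ.trans (min_le_left _ _)]

/-- Within `n` moves all outputs become moderate while the total output stays at least
`gammaOf c a x`. Only agents with a large output move; if all positive outputs are large, two
large agents move last, and the definition of `gammaOf` bounds what the first of them leaves. -/
theorem exists_reaches_moderate (hn : 3 ≤ n) (hc : IsCost c) (ha : 0 < a) (ha1 : a < 1)
    (hx : ∀ j, 0 ≤ x j) :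
    ∃ (t : ℕ) (y : Fin n → ℝ), t ≤ n ∧ Reaches c a x t y ∧ (∀ j, Moderate n (y j)) ∧
      gammaOf c a x ≤ ∑ j, y j := by
  classical
  have hn' : (3 : ℝ) ≤ n := by exact_mod_cast hn
  have : NeZero n := ⟨by omega⟩
  have hγa : gammaOf c a x ≤ a := gammaOf_le hn hc ha ha1 hx (Or.inl (Or.inl rfl))
  have hcard : ∀ A : Finset (Fin n), A.card ≤ n := fun A => by
    simpa using Finset.card_le_univ A
  set G := Finset.univ.filter fun j => ¬ Moderate n (x j) with hGdef
  have hG : ∀ j, j ∈ G ↔ ¬ Moderate n (x j) := fun j => by simp [hGdef]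
  have hbig : ∀ j ∈ G, (n : ℝ) ^ 2 ≤ 4 * ((n : ℝ) - 1) * x j := fun j hj => by
    rw [hG, Moderate, not_and, not_le] at hj
    exact (hj (hx j)).le
  by_cases hmid : ∃ m ∉ G, 0 < x m
  · obtain ⟨m, hmG, hm⟩ := hmid
    obtain ⟨y, hy, hy0, hyG, hym, -⟩ := exists_sweep hn hc ha ha1 hx G
    refine ⟨_, y, hcard G, hy, fun j => ?_, ?_⟩
    · by_cases hj : j ∈ G
      · exact hym j hj
      · rw [hyG j hj]
        by_contra h
        exact hj ((hG j).2 h)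
    · calc gammaOf c a x ≤ x m := gammaOf_le hn hc ha ha1 hx (Or.inl (Or.inr ⟨m, hm, rfl⟩))
        _ = y m := (hyG m hmG).symm
        _ ≤ ∑ j, y j := Finset.single_le_sum (fun j _ => hy0 j) (Finset.mem_univ m)
  push Not at hmid
  have hzero : ∀ j ∉ G, x j = 0 := fun j hj => le_antisymm (hmid j hj) (hx j)
  have hmod0 : Moderate n 0 := ⟨le_rfl, by simp⟩
  -- if all agents but `g` are at `0`, then `g` moves to `a`
  have hlast : ∀ (t : ℕ) (y : Fin n → ℝ) (g : Fin n), t + 1 ≤ n → Reaches c a x t y →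
      (∀ j, j ≠ g → y j = 0) → ∃ (t : ℕ) (y : Fin n → ℝ), t ≤ n ∧ Reaches c a x t y ∧
        (∀ j, Moderate n (y j)) ∧ gammaOf c a x ≤ ∑ j, y j := fun t y g ht hy hyg => by
    have ho : others y g = 0 := Finset.sum_eq_zero fun j hj => hyg j (Finset.ne_of_mem_erase hj)
    refine ⟨t + 1, _, ht, .step g hy, fun j => ?_, ?_⟩
    · by_cases h : j = g
      · subst h
        rw [move_self]
        exact moderate_bestResponse hn hc ha ha1 ho.ge
      · rw [move_of_ne h, hyg j h]
        exact hmod0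
    · rw [total_move, ho, bestResponse_zero, zero_add]
      exact hγa
  rcases G.eq_empty_or_nonempty with hGe | ⟨g, hgG⟩
  · exact hlast 0 x 0 (by omega) .refl fun j _ => hzero j (by simp [hGe])
  by_cases hκ : 0 < marginal c 0 ∧ threshold n c ≤ x g
  · obtain ⟨y, hy, -, hyG, -, hyg⟩ := exists_sweep hn hc ha ha1 hx (G.erase g)
    refine hlast _ y g ?_ hy fun j hj => ?_
    · have := Finset.card_erase_add_one hgG
      have := hcard G
      omega
    · by_cases hjG : j ∈ G
      · obtain ⟨s, hs, hys⟩ := hyg g (Finset.notMem_erase g G) j (Finset.mem_erase.2 ⟨hj, hjG⟩)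
        rw [hys]
        exact bestResponse_eq_zero hn hc hκ.1 (hκ.2.trans hs)
      · rw [hyG j fun h => hjG (Finset.mem_of_mem_erase h)]
        exact hzero j hjG
  by_cases hone : ∃ k ∈ G, k ≠ g
  · obtain ⟨k, hkG, hkg⟩ := hone
    obtain ⟨y, hy, hy0, hyG, hym, -⟩ := exists_sweep hn hc ha ha1 hx ((G.erase g).erase k)
    have hyA : ∀ j, j ≠ k → j ≠ g → Moderate n (y j) := fun j hjk hjg => by
      by_cases hjG : j ∈ G
      · exact hym j (Finset.mem_erase.2 ⟨hjk, Finset.mem_erase.2 ⟨hjg, hjG⟩⟩)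
      · rw [hyG j fun h => hjG (Finset.mem_of_mem_erase (Finset.mem_of_mem_erase h)),
          hzero j hjG]
        exact hmod0
    have hyg : y g = x g := hyG g fun h =>
      Finset.notMem_erase g G (Finset.mem_of_mem_erase h)
    have hcd : ((G.erase g).erase k).card + 1 + 1 = G.card := by
      rw [Finset.card_erase_add_one (Finset.mem_erase.2 ⟨hkg, hkG⟩),
        Finset.card_erase_add_one hgG]
    have h0' := nonneg_move hn hc ha ha1 hy0 k
    refine ⟨_, _, (hcd.trans_le (hcard G)), .step g (.step k hy), fun j => ?_, ?_⟩
    · by_cases hjg : j = g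
      · subst hjg
        rw [move_self]
        exact moderate_bestResponse hn hc ha ha1 (others_nonneg h0' _)
      rw [move_of_ne hjg]
      by_cases hjk : j = k
      · subst hjk
        rw [move_self]
        exact moderate_bestResponse hn hc ha ha1 (others_nonneg hy0 _)
      · rw [move_of_ne hjk]
        exact hyA j hjk hjg
    · have hr : 0 ≤ others y k - x g := by
        rw [← hyg]
        exact sub_nonneg.2 (le_others hy0 hkg.symm)
      have h1 := gammaOf_le_add_bestResponse hn hc ha ha1 hx (hbig g hgG)
        (fun h => lt_of_not_ge fun h' => hκ ⟨h, h'⟩) hr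
      have h2 : others (move c a y k) g =
          others y k - x g + bestResponse n c a (x g + (others y k - x g)) := by
        rw [others_eq, total_move, move_of_ne hkg.symm, hyg]
        ring_nf
      rw [total_move, h2]
      have h3 := (moderate_bestResponse hn hc ha ha1 (others_nonneg h0' g)).1
      rw [h2] at h3
      linarith
  · push Not at hone
    refine hlast 0 x g (by omega) .refl fun j hj => hzero j fun h => hj (hone j h)

theorem exists_nat_exp_neg_le {γ : ℝ} (hγ : 0 < γ) (hγ1 : γ < 1) :
    ∃ k : ℕ, (k : ℝ) ≤ 2 * logLog γ + 1 ∧ Real.exp (-2 ^ k) ≤ γ := by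
  have hL : 0 < Real.log (1 / γ) := Real.log_pos (by rw [lt_div_iff₀ hγ]; linarith)
  have hl0 : 0 ≤ logLog γ := le_max_left _ _
  have hlog2 := Real.log_two_gt_d9
  refine ⟨⌈logLog γ / Real.log 2⌉₊, ?_, ?_⟩
  · have h1 : (⌈logLog γ / Real.log 2⌉₊ : ℝ) < logLog γ / Real.log 2 + 1 :=
      Nat.ceil_lt_add_one (by positivity)
    have h2 : logLog γ / Real.log 2 ≤ 2 * logLog γ := by
      rw [div_le_iff₀ (by positivity)]
      nlinarith
    linarith
  · have h1 : logLog γ ≤ ⌈logLog γ / Real.log 2⌉₊ * Real.log 2 :=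
      (div_le_iff₀ (by positivity)).1 (Nat.le_ceil _)
    set k := ⌈logLog γ / Real.log 2⌉₊
    have h2 : Real.log (1 / γ) ≤ 2 ^ k := by
      rw [← Real.log_le_log_iff hL (by positivity), Real.log_pow]
      exact (le_max_right _ _).trans h1
    rw [← Real.le_log_iff_exp_le hγ]
    rw [one_div, Real.log_inv] at h2
    linarith

/-- The upper bound: an initial sweep, growth to total output `1`, and linear convergence. -/
theorem exists_fast_selection (hn : 3 ≤ n) (ha : 0 < a) (ha1 : a < 1) (hc : IsCost c) {ε K : ℝ}
    (hε : 0 < ε) (hε1 : ε < 1) (hK : LipschitzNearOne c K ε) (hx : ∀ j, 0 ≤ x j) :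
    ∃ (i : ℕ → Fin n) (t : ℕ),
      (t : ℝ) ≤ 27 * (logLog (gammaOf c a x) + n * Real.log (n * K / ε)) ∧
      IsApproxEquilibrium c ε (dynamics c a x i t) := by
  have hn' : (3 : ℝ) ≤ n := by exact_mod_cast hn
  have : NeZero n := ⟨by omega⟩
  have hK1 := hc.one_le_lipschitz hε hK
  obtain ⟨t₁, x₁, ht₁, hx₁, hm₁, hS₁⟩ := exists_reaches_moderate hn hc ha ha1 hx
  have hγa : gammaOf c a x ≤ a := gammaOf_le hn hc ha ha1 hx (Or.inl (Or.inl rfl))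
  obtain ⟨k, hk, hkγ⟩ := exists_nat_exp_neg_le (gammaOf_pos hn hc ha hx) (hγa.trans_lt ha1)
  obtain ⟨t₂, x₂, ht₂, hx₂, hm₂, hS₂⟩ :=
    exists_reaches_one hn hc ha ha1 hm₁ k (hkγ.trans hS₁)
  set δ : ℝ := ε / (6 * (n : ℝ) ^ 2 * K) with hδ
  have hδ0 : 0 < δ := by positivity
  have hδe : δ * (6 * (n : ℝ) ^ 2 * K) = ε := by rw [hδ]; field_simp
  have hδ1 : δ ≤ 1 := by
    rw [hδ, div_le_one (by positivity)]
    nlinarith [mul_le_mul_of_nonneg_left hK1 (sq_nonneg (n : ℝ))]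
  obtain ⟨t₃, x₃, ht₃, hx₃, hV⟩ := exists_reaches_near hn hc ha ha1 hm₂ hS₂ hδ0 hδ1
  obtain ⟨i, hi⟩ := ((hx₁.trans hx₂).trans hx₃).exists_dynamics
  refine ⟨i, t₁ + t₂ + t₃, ?_, hi ▸ isApproxEquilibrium_of_near hn hc hε hε1 hK hδe.le hV⟩
  set Q : ℝ := n * K / ε with hQ
  have hQn : (n : ℝ) ≤ Q := by
    rw [hQ, le_div_iff₀ hε]
    nlinarith
  have hlogQ : 1 ≤ Real.log Q := by
    rw [Real.le_log_iff_exp_le (by linarith)]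
    linarith [Real.exp_one_lt_d9]
  have hlog : Real.log ((n : ℝ) ^ 2 / δ) ≤ 6 * Real.log Q := by
    have h1 : (n : ℝ) ^ 2 / δ ≤ Q ^ 6 := by
      have h2 : (n : ℝ) ^ 2 / δ = 6 * n ^ 3 * Q := by
        rw [hδ, hQ]; field_simp
      have h3 : (n : ℝ) ^ 3 ≤ Q ^ 3 := by gcongr
      have h4 : 6 ≤ Q ^ 2 := by nlinarith
      have hQ0 : 0 ≤ Q := by linarith
      calc _ = 6 * n ^ 3 * Q := h2
        _ ≤ Q ^ 2 * Q ^ 3 * Q := by gcongr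
        _ = Q ^ 6 := by ring
    have h5 := Real.log_le_log (by positivity) h1
    rw [Real.log_pow] at h5
    exact_mod_cast h5
  have hl0 : 0 ≤ logLog (gammaOf c a x) := le_max_left _ _
  have h1 : (t₁ : ℝ) ≤ n := by exact_mod_cast ht₁
  have h2 : (t₂ : ℝ) ≤ k + 1 := by exact_mod_cast ht₂
  have h3 : 4 * (n : ℝ) * Real.log ((n : ℝ) ^ 2 / δ) ≤ 4 * n * (6 * Real.log Q) := by gcongr
  have h4 : (n : ℝ) ≤ n * Real.log Q := le_mul_of_one_le_right (by linarith) hlogQ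
  push_cast
  linarith

end UpperBound

/-! ### The dynamics under linear cost -/

section Linear

variable {n : ℕ} {a : ℝ} {x : Fin n → ℝ}

/-- The linear cost function. -/
def linearCost : ℝ → ℝ := fun z => z

theorem marginal_linearCost {z : ℝ} (hz : 0 ≤ z) : marginal linearCost z = 1 :=
  derivWithin_id' z _ (uniqueDiffOn_Ici 0 z hz)

theorem isCost_linearCost : IsCost linearCost where
  differentiableOn := differentiableOn_id
  marginal_differentiableOn :=
    (differentiableOn_const 1).congr fun _ hz => marginal_linearCost hz
  marginal_pos z hz := by rw [marginal_linearCost hz.le]; exact one_pos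
  convex z hz := by
    have h : Set.EqOn (marginal linearCost) (fun _ => 1) (Set.Ici 0) :=
      fun _ h => marginal_linearCost h
    rw [derivWithin_congr h (h hz)]
    simp
  zero := rfl
  marginal_one := marginal_linearCost zero_le_one

theorem threshold_linearCost : threshold n linearCost = (n : ℝ) ^ 2 / ((n : ℝ) - 1) := by
  rw [threshold, marginal_linearCost le_rfl, one_mul]

theorem threshold_mul (hn : 3 ≤ n) :
    threshold n linearCost * ((n : ℝ) - 1) = (n : ℝ) ^ 2 := by
  have hn' : (3 : ℝ) ≤ n := by exact_mod_cast hn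
  rw [threshold_linearCost, div_mul_cancel₀]
  linarith

theorem four_le_threshold (hn : 3 ≤ n) : 4 ≤ threshold n linearCost := by
  have hn' : (3 : ℝ) ≤ n := by exact_mod_cast hn
  rw [threshold_linearCost, le_div_iff₀ (by linarith)]
  nlinarith [sq_nonneg ((n : ℝ) - 2)]

theorem threshold_le (hn : 3 ≤ n) : threshold n linearCost ≤ 3 / 2 * n := by
  have hn' : (3 : ℝ) ≤ n := by exact_mod_cast hn
  rw [threshold_linearCost, div_le_iff₀ (by linarith)]
  nlinarith

theorem bestResponse_linearCost (hn : 3 ≤ n) {s : ℝ} (hs : 0 < s)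
    (hs' : s < threshold n linearCost) :
    bestResponse n linearCost a s = √(threshold n linearCost * s) - s := by
  have hn' : (3 : ℝ) ≤ n := by exact_mod_cast hn
  have hκ := threshold_mul hn
  have hz0 := (bestResponse_spec (a := a) hn isCost_linearCost hs).1
  obtain ⟨h1, h2⟩ := bestResponse_foc (a := a) hn isCost_linearCost hs rfl
  set z := bestResponse n linearCost a s
  set κ := threshold n linearCost
  rw [marginal_linearCost hz0, mul_one, ← hκ] at h1 h2
  have hz : 0 < z := by
    refine lt_of_le_of_ne hz0 fun h => ?_
    rw [← h, zero_add] at h1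
    have h3 : 0 < ((n : ℝ) - 1) * s := mul_pos (by linarith) hs
    nlinarith
  have h3 : κ * s = (z + s) ^ 2 := by
    have := h2 hz
    have h4 : (n : ℝ) - 1 ≠ 0 := by linarith
    exact mul_left_cancel₀ h4 (by linarith)
  rw [h3, Real.sqrt_sq (by linarith)]
  ring

/-- Two agents have positive outputs and the total output is below the threshold. This is an
invariant of the dynamics under linear cost, so that best responses are always given by the
formula `bestResponse_linearCost`. -/
structure Live (x : Fin n → ℝ) : Prop where
  nonneg : ∀ j, 0 ≤ x j
  two_pos : ∃ j k, j ≠ k ∧ 0 < x j ∧ 0 < x k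
  total_lt : ∑ j, x j < threshold n linearCost

namespace Live

theorem exists_pos (hx : Live x) (i : Fin n) : ∃ j, j ≠ i ∧ 0 < x j := by
  obtain ⟨j, k, hjk, hj, hk⟩ := hx.two_pos
  by_cases h : j = i
  · exact ⟨k, fun h' => hjk (h.trans h'.symm), hk⟩
  · exact ⟨j, h, hj⟩

theorem others_pos (hx : Live x) (i : Fin n) : 0 < others x i := by
  obtain ⟨j, hji, hj⟩ := hx.exists_pos i
  exact hj.trans_le (le_others hx.nonneg hji)

theorem others_le_total (hx : Live x) (i : Fin n) : others x i ≤ ∑ j, x j := by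
  rw [others_eq]
  linarith [hx.nonneg i]

theorem total_pos (hx : Live x) : 0 < ∑ j, x j := by
  obtain ⟨j, -, -, hj, -⟩ := hx.two_pos
  exact hj.trans_le (Finset.single_le_sum (fun j _ => hx.nonneg j) (Finset.mem_univ j))

theorem bestResponse_others (hn : 3 ≤ n) (hx : Live x) (i : Fin n) :
    bestResponse n linearCost a (others x i) =
      √(threshold n linearCost * others x i) - others x i :=
  bestResponse_linearCost hn (hx.others_pos i) ((hx.others_le_total i).trans_lt hx.total_lt)

theorem total_move (hn : 3 ≤ n) (hx : Live x) (i : Fin n) :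
    ∑ j, move linearCost a x i j = √(threshold n linearCost * others x i) := by
  rw [Tullock.total_move, hx.bestResponse_others hn]
  ring

theorem move (hn : 3 ≤ n) (hx : Live x) (i : Fin n) : Live (move linearCost a x i) := by
  have hκ := four_le_threshold hn
  have hs := hx.others_pos i
  have hlt := (hx.others_le_total i).trans_lt hx.total_lt
  have hpos : 0 < bestResponse n linearCost a (others x i) := by
    rw [hx.bestResponse_others hn, sub_pos]
    refine Real.lt_sqrt_of_sq_lt ?_
    nlinarith
  refine ⟨fun j => ?_, ?_, ?_⟩
  · by_cases h : j = i
    · subst h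
      rw [move_self]
      exact hpos.le
    · rw [move_of_ne h]
      exact hx.nonneg j
  · obtain ⟨j, hji, hj⟩ := hx.exists_pos i
    exact ⟨j, i, hji, by rwa [move_of_ne hji], by rwa [move_self]⟩
  · rw [hx.total_move hn, Real.sqrt_lt' (by linarith)]
    nlinarith

/-- Under linear cost the loss of an agent against the best response is a perfect square: writing
`κ` for the threshold, `S` for the total output, `s` for that of the others, the best utility is
`(1 - √(s / κ)) ^ 2` and the loss is `(√(S / κ) - √(s / S)) ^ 2`. -/
theorem abs_sqrt_sub_sqrt_le (hn : 3 ≤ n) (hx : Live x) {ε : ℝ} (hε : 0 ≤ ε)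
    (h : IsApproxEquilibrium linearCost ε x) (i : Fin n) :
    |√((∑ j, x j) / threshold n linearCost) - √(others x i / ∑ j, x j)| ≤
      √ε * (1 - √((∑ j, x j) / threshold n linearCost) * √(others x i / ∑ j, x j)) := by
  have hn' : (3 : ℝ) ≤ n := by exact_mod_cast hn
  have hκ := four_le_threshold hn
  have hκn := threshold_mul hn
  have hSpos := hx.total_pos
  have hSκ := hx.total_lt
  have hs := hx.others_pos i
  have hsS := hx.others_le_total i
  have hxi : x i = ∑ j, x j - others x i := by rw [others_eq]; ring
  have hxi0 := hx.nonneg i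
  have happ := h i _ (bestResponse_spec (a := 0) hn isCost_linearCost hs).1
  have hBR0 := (bestResponse_spec (a := 0) hn isCost_linearCost hs).1
  rw [utility_of_pos hBR0 hs, utility_of_pos hxi0 hs, hx.bestResponse_others hn] at happ
  set S := ∑ j, x j
  set s := others x i
  set κ := threshold n linearCost
  have hα : ((n : ℝ) - 1) / (n : ℝ) ^ 2 = 1 / κ := by
    rw [← hκn]
    have : (n : ℝ) - 1 ≠ 0 := by linarith
    field_simp
  have hu2 : √(S / κ) ^ 2 = S / κ := Real.sq_sqrt (by positivity)
  have hv2 : √(s / S) ^ 2 = s / S := Real.sq_sqrt (by positivity)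
  have hu0 := Real.sqrt_nonneg (S / κ)
  have hv0 := Real.sqrt_nonneg (s / S)
  have hupos : 0 < √(S / κ) := Real.sqrt_pos.2 (by positivity)
  have hvpos : 0 < √(s / S) := Real.sqrt_pos.2 (by positivity)
  have hu1 : √(S / κ) ≤ 1 := Real.sqrt_le_one.2 ((div_le_one (by linarith)).2 hSκ.le)
  have hv1 : √(s / S) ≤ 1 := Real.sqrt_le_one.2 ((div_le_one hSpos).2 hsS)
  set u := √(S / κ)
  set v := √(s / S)
  have hS : S = κ * u ^ 2 := by rw [hu2]; field_simp
  have hsv : s = S * v ^ 2 := by rw [hv2]; field_simp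
  have hsuv : s = κ * (u * v) ^ 2 := by rw [hsv, hS]; ring
  have hroot : √(κ * s) = κ * (u * v) := by
    rw [hsuv, show κ * (κ * (u * v) ^ 2) = (κ * (u * v)) ^ 2 by ring]
    exact Real.sqrt_sq (by positivity)
  have huv : u * v ≤ 1 := mul_le_one₀ hu1 hv0 hv1
  have hbest : (√(κ * s) - s) / (√(κ * s) - s + s) -
      1 / κ * linearCost (√(κ * s) - s) = (1 - u * v) ^ 2 := by
    rw [sub_add_cancel, hroot, hsuv, linearCost]
    field_simp
  have hcur : x i / (x i + s) - 1 / κ * linearCost (x i) = (1 - u * v) ^ 2 - (u - v) ^ 2 := by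
    rw [hxi, sub_add_cancel, hsv, hS, linearCost]
    field_simp
    ring
  rw [hα, hbest, hcur] at happ
  refine abs_le_of_sq_le_sq ?_ (mul_nonneg (Real.sqrt_nonneg _) (by linarith))
  rw [mul_pow, Real.sq_sqrt hε]
  linarith

theorem ratio_lt_one (hn : 3 ≤ n) (hx : Live x) : (∑ j, x j) / threshold n linearCost < 1 := by
  rw [div_lt_one (by linarith [four_le_threshold hn])]
  exact hx.total_lt

theorem ratio_pos (hn : 3 ≤ n) (hx : Live x) : 0 < (∑ j, x j) / threshold n linearCost :=
  div_pos hx.total_pos (by linarith [four_le_threshold hn])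

/-! ### Necessary conditions for approximate equilibria under linear cost -/

theorem ne_zero_of_isApproxEquilibrium (hn : 3 ≤ n) (hx : Live x) {ε : ℝ} (hε : 0 ≤ ε) (hε1 : ε < 1)
    (h : IsApproxEquilibrium linearCost ε x) (i : Fin n) : x i ≠ 0 := by
  intro h0
  have h1 := hx.abs_sqrt_sub_sqrt_le hn hε h i
  rw [others_eq, h0, sub_zero, div_self hx.total_pos.ne', Real.sqrt_one, mul_one] at h1
  have h2 : √((∑ j, x j) / threshold n linearCost) < 1 := by
    rw [Real.sqrt_lt' one_pos, one_pow]
    exact hx.ratio_lt_one hn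
  have h3 : √ε < 1 := by rwa [Real.sqrt_lt' one_pos, one_pow]
  have h4 := (abs_le.1 h1).1
  nlinarith

/-- Right after a move, the mover holds a large share of a small total output, so that the
profile is no approximate equilibrium unless the total output is bounded below. -/
theorem le_ratio_of_isApproxEquilibrium (hn : 3 ≤ n) (hx : Live x) (i : Fin n) {ε : ℝ}
    (hε : 0 ≤ ε) (hε1 : ε < 1)
    (h : IsApproxEquilibrium linearCost ε (Tullock.move linearCost a x i)) :
    (1 - √ε) ^ 2 / 4 ≤ (∑ j, Tullock.move linearCost a x i j) / threshold n linearCost := by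
  have hκ := four_le_threshold hn
  have hy := hx.move (a := a) hn i
  obtain ⟨k, hki, -⟩ := hx.exists_pos i
  have h1 := hy.abs_sqrt_sub_sqrt_le hn hε h k
  have hσ1 := hy.ratio_lt_one hn
  have hσ0 := hy.ratio_pos hn
  have hSpos := hy.total_pos
  have hsk : ∑ j, Tullock.move linearCost a x i j - others x i ≤
      others (Tullock.move linearCost a x i) k := by
    rw [others_eq _ k, move_of_ne hki]
    linarith [le_others hx.nonneg hki]
  have htot : (∑ j, Tullock.move linearCost a x i j) ^ 2 =
      threshold n linearCost * others x i := by
    rw [hx.total_move hn, Real.sq_sqrt]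
    have := hx.others_pos i
    positivity
  set S := ∑ j, Tullock.move linearCost a x i j
  set κ := threshold n linearCost
  have hq : 1 - S / κ ≤ others (Tullock.move linearCost a x i) k / S := by
    rw [le_div_iff₀ hSpos]
    refine le_trans (le_of_eq ?_) hsk
    have h2 : others x i = S ^ 2 / κ := by rw [htot]; field_simp
    rw [h2]; ring
  have hv : 1 - S / κ ≤ √(others (Tullock.move linearCost a x i) k / S) := by
    refine Real.le_sqrt_of_sq_le (le_trans ?_ hq)
    nlinarith
  have hu2 : √(S / κ) ^ 2 = S / κ := Real.sq_sqrt hσ0.le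
  have hu0 := Real.sqrt_nonneg (S / κ)
  have hv0 := Real.sqrt_nonneg (others (Tullock.move linearCost a x i) k / S)
  have hu1 : √(S / κ) ≤ 1 := Real.sqrt_le_one.2 hσ1.le
  have h3 : √ε ≤ 1 := Real.sqrt_le_one.2 hε1.le
  have h4 := (abs_le.1 h1).1
  have h5 : √ε * (1 - √(S / κ) * √(others (Tullock.move linearCost a x i) k / S)) ≤ √ε :=
    mul_le_of_le_one_right (Real.sqrt_nonneg _) (by nlinarith)
  have h6 : (1 - √ε) / 2 ≤ √(S / κ) := by nlinarith
  calc (1 - √ε) ^ 2 / 4 = ((1 - √ε) / 2) ^ 2 := by ring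
    _ ≤ √(S / κ) ^ 2 := pow_le_pow_left₀ (by linarith) h6 2
    _ = S / κ := hu2

/-- In an approximate equilibrium all outputs are close to `1`: with `σ` the ratio of the total
output to the threshold, all the shares `1 - x i / S` are close to `σ`, and they add up to
`n - 1`. -/
theorem abs_sub_one_le_of_isApproxEquilibrium (hn : 3 ≤ n) (hx : Live x) {ε : ℝ} (hε : 0 ≤ ε)
    (h : IsApproxEquilibrium linearCost ε x) (i : Fin n) : |x i - 1| ≤ 9 * n * √ε := by
  have hn' : (3 : ℝ) ≤ n := by exact_mod_cast hn
  have hκ := four_le_threshold hn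
  have hκn := threshold_mul hn
  have hκ3 := threshold_le hn
  have hSpos := hx.total_pos
  have hσ1 := hx.ratio_lt_one hn
  have hσ0 := hx.ratio_pos hn
  set κ := threshold n linearCost
  set S := ∑ j, x j with hS
  set σ := S / κ with hσ
  have hclose : ∀ j, |σ - others x j / S| ≤ 2 * √ε := fun j => by
    have h1 := hx.abs_sqrt_sub_sqrt_le hn hε h j
    have hq0 : 0 ≤ others x j / S := div_nonneg (hx.others_pos j).le hSpos.le
    have hq1 : others x j / S ≤ 1 := (div_le_one hSpos).2 (hx.others_le_total j)
    have hu2 : √σ ^ 2 = σ := Real.sq_sqrt hσ0.le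
    have hv2 : √(others x j / S) ^ 2 = others x j / S := Real.sq_sqrt hq0
    have hu0 := Real.sqrt_nonneg σ
    have hv0 := Real.sqrt_nonneg (others x j / S)
    have hu1 : √σ ≤ 1 := Real.sqrt_le_one.2 hσ1.le
    have hv1 : √(others x j / S) ≤ 1 := Real.sqrt_le_one.2 hq1
    have h2 : √ε * (1 - √σ * √(others x j / S)) ≤ √ε :=
      mul_le_of_le_one_right (Real.sqrt_nonneg _) (by nlinarith)
    have h3 : |√σ - √(others x j / S)| ≤ √ε := h1.trans h2
    rw [← hu2, ← hv2, sq_sub_sq, abs_mul, abs_of_nonneg (by linarith)]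
    exact mul_le_mul (by linarith) h3 (abs_nonneg _) zero_le_two
  have hsum : ∑ j, (σ - others x j / S) = n * σ - (n - 1) := by
    have h1 : ∑ j, others x j / S = n - 1 := by
      rw [← Finset.sum_div, Finset.sum_congr rfl fun j _ => others_eq x j,
        Finset.sum_sub_distrib]
      simp only [Finset.sum_const, Finset.card_univ, Fintype.card_fin, nsmul_eq_mul, ← hS]
      field_simp
    rw [Finset.sum_sub_distrib, h1]
    simp
  have hη : |n * σ - (n - 1)| ≤ n * (2 * √ε) := by
    rw [← hsum]
    refine (Finset.abs_sum_le_sum_abs _ _).trans ?_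
    refine (Finset.sum_le_sum fun j _ => hclose j).trans ?_
    simp
  have hxi : x i = κ * σ * (1 - others x i / S) := by
    rw [hσ, others_eq, ← hS]
    field_simp
    ring
  have hc := hclose i
  set e := √ε
  have he : 0 ≤ e := Real.sqrt_nonneg _
  obtain ⟨δ, hδ⟩ : ∃ δ, others x i / S = σ - δ := ⟨σ - others x i / S, by ring⟩
  obtain ⟨η, hηd⟩ : ∃ η, n * σ - (n - 1) = n * η := ⟨σ - (n - 1) / n, by field_simp⟩
  rw [hδ, sub_sub_cancel] at hc
  rw [hηd, abs_mul, Nat.abs_cast] at hη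
  have hη' : |η| ≤ 2 * e := le_of_mul_le_mul_left hη (by linarith)
  have hid : n * (x i - 1) = κ * (η + n * σ * (δ - η)) := by
    have h2 : 1 * (n : ℝ) ^ 2 = κ * (n - 1) := by linarith
    have h4 : n * (n * (x i - 1)) = n * (κ * (η + n * σ * (δ - η))) := by
      rw [hxi, hδ]
      have h5 : (n : ℝ) * σ = n * η + (n - 1) := by linarith
      linear_combination (-1) * h2 + κ * (1 - n * σ) * h5
    exact mul_left_cancel₀ (by linarith : (n : ℝ) ≠ 0) h4
  have hb : |η + n * σ * (δ - η)| ≤ 2 * e + n * (4 * e) := by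
    refine (abs_add_le _ _).trans (add_le_add hη' ?_)
    rw [abs_mul, abs_of_nonneg (by positivity)]
    have h6 : |δ - η| ≤ 4 * e := (abs_sub _ _).trans (by linarith)
    have h7 : n * σ ≤ n := mul_le_of_le_one_right (by linarith) hσ1.le
    exact mul_le_mul h7 h6 (abs_nonneg _) (by linarith)
  have hfin : n * |x i - 1| ≤ n * (9 * n * e) := by
    have h8 : n * |x i - 1| = κ * |η + n * σ * (δ - η)| := by
      rw [← abs_of_nonneg (by linarith : (0 : ℝ) ≤ n), ← abs_mul, hid, abs_mul,
        abs_of_nonneg (by linarith : 0 ≤ κ), abs_of_nonneg (by linarith : (0 : ℝ) ≤ n)]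
    rw [h8]
    calc κ * |η + n * σ * (δ - η)| ≤ 3 / 2 * n * (2 * e + n * (4 * e)) :=
          mul_le_mul hκ3 hb (abs_nonneg _) (by positivity)
      _ ≤ n * (9 * n * e) := by nlinarith [mul_nonneg he (by linarith : (0 : ℝ) ≤ n)]
  exact le_of_mul_le_mul_left hfin (by linarith)

end Live

/-! ### How slowly distances to the equilibrium can shrink -/

/-- Two agents have outputs at distance at least `d` from the equilibrium output. (A single such
agent could move to the equilibrium in one step.) -/
def Far (d : ℝ) (x : Fin n → ℝ) : Prop :=
  ∃ j k, j ≠ k ∧ d ≤ |x j - 1| ∧ d ≤ |x k - 1|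

/-- `(√(κ * s) - s - 1) * (√(κ * s) + s + 1)` is a quadratic polynomial with the zeros `n - 1` and
`1 / (n - 1)`; the hypothesis `5 / 6 ≤ s` keeps away from the second one. -/
theorem abs_bestResponse_sub_one_ge (hn : 3 ≤ n) {s : ℝ} (hs : 5 / 6 ≤ s)
    (hs' : s < threshold n linearCost) :
    |s - ((n : ℝ) - 1)| ≤ 10 * n * |bestResponse n linearCost a s - 1| := by
  have hn' : (3 : ℝ) ≤ n := by exact_mod_cast hn
  have hκ := four_le_threshold hn
  have hκn := threshold_mul hn
  have hκ3 := threshold_le hn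
  rw [bestResponse_linearCost hn (by linarith) hs']
  set κ := threshold n linearCost
  have hr0 := Real.sqrt_nonneg (κ * s)
  have hr2 : √(κ * s) ^ 2 = κ * s := Real.sq_sqrt (by positivity)
  have hrκ : √(κ * s) ≤ κ := by
    rw [Real.sqrt_le_left (by linarith)]
    nlinarith
  set r := √(κ * s)
  have hid : ((n : ℝ) - 1) * (r - s - 1) * (r + s + 1) =
      -((((n : ℝ) - 1) * s - 1) * (s - (n - 1))) := by
    linear_combination ((n : ℝ) - 1) * hr2 + s * hκn
  have habs : ((n : ℝ) - 1) * |r - s - 1| * (r + s + 1) =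
      (((n : ℝ) - 1) * s - 1) * |s - (n - 1)| := by
    have h1 := congrArg abs hid
    rwa [abs_neg, abs_mul, abs_mul, abs_mul, abs_of_nonneg (by linarith : (0 : ℝ) ≤ (n : ℝ) - 1),
      abs_of_nonneg (by linarith : (0 : ℝ) ≤ r + s + 1),
      abs_of_nonneg (by nlinarith : (0 : ℝ) ≤ ((n : ℝ) - 1) * s - 1)] at h1
  have h2 : ((n : ℝ) - 1) * (1 / 3) ≤ ((n : ℝ) - 1) * s - 1 := by nlinarith
  have h3 : r + s + 1 ≤ 10 / 3 * n := by linarith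
  have h4 : ((n : ℝ) - 1) * (1 / 3) * |s - (n - 1)| ≤
      ((n : ℝ) - 1) * |r - s - 1| * (10 / 3 * n) :=
    calc _ ≤ (((n : ℝ) - 1) * s - 1) * |s - (n - 1)| :=
          mul_le_mul_of_nonneg_right h2 (abs_nonneg _)
      _ = ((n : ℝ) - 1) * |r - s - 1| * (r + s + 1) := habs.symm
      _ ≤ _ := mul_le_mul_of_nonneg_left h3 (mul_nonneg (by linarith) (abs_nonneg _))
  refine le_of_mul_le_mul_left ?_ (by linarith : 0 < ((n : ℝ) - 1) * (1 / 3))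
  linarith

theorem Far.move (hn : 3 ≤ n) (hx : Live x) {d : ℝ} (hd : 0 ≤ d) (hd1 : d ≤ 1) (h : Far d x)
    (i : Fin n) : Far (d / (n : ℝ) ^ 4) (move linearCost a x i) := by
  have hn' : (3 : ℝ) ≤ n := by exact_mod_cast hn
  obtain ⟨k, hki, hk⟩ : ∃ k, k ≠ i ∧ d ≤ |x k - 1| := by
    obtain ⟨j, k, hjk, hj, hk⟩ := h
    by_cases h : j = i
    · exact ⟨k, fun h' => hjk (h.trans h'.symm), hk⟩
    · exact ⟨j, h, hj⟩
  have hn3 : (27 : ℝ) ≤ (n : ℝ) ^ 3 := by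
    calc (27 : ℝ) = 3 ^ 3 := by norm_num
      _ ≤ (n : ℝ) ^ 3 := by gcongr
  have hn4 : 20 * (n : ℝ) ≤ (n : ℝ) ^ 4 := by
    rw [pow_succ]
    nlinarith
  have hd20 : d / (n : ℝ) ^ 4 ≤ d / (20 * n) := by gcongr
  have hd2 : d / (20 * (n : ℝ)) ≤ d / (2 * n) := by gcongr; norm_num
  have hd0 : d / (2 * (n : ℝ)) ≤ d := div_le_self hd (by linarith)
  by_cases hj : ∃ j, j ≠ i ∧ j ≠ k ∧ d / (2 * n) ≤ |x j - 1|
  · obtain ⟨j, hji, hjk, hj⟩ := hj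
    refine ⟨j, k, hjk, ?_, ?_⟩
    · rw [move_of_ne hji]; linarith
    · rw [move_of_ne hki]; linarith
  -- otherwise `k` dominates the sum that `i` responds to
  push Not at hj
  refine ⟨i, k, hki.symm, ?_, by rw [move_of_ne hki]; linarith⟩
  rw [move_self]
  obtain ⟨j, hji, hjk⟩ : ∃ j, j ≠ i ∧ j ≠ k := by
    have hlt : ({i, k} : Finset (Fin n)).card < (Finset.univ : Finset (Fin n)).card := by
      rw [Finset.card_univ, Fintype.card_fin]
      exact Finset.card_le_two.trans_lt (by omega)
    obtain ⟨j, -, hj⟩ := Finset.exists_mem_notMem_of_card_lt_card hlt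
    simp only [Finset.mem_insert, Finset.mem_singleton, not_or] at hj
    exact ⟨j, hj.1, hj.2⟩
  have hs : 5 / 6 ≤ others x i := by
    refine le_trans ?_ (le_others hx.nonneg hji)
    have h1 := (abs_lt.1 (hj j hji hjk)).1
    have h2 : d / (2 * (n : ℝ)) ≤ 1 / 6 := by
      rw [div_le_iff₀ (by positivity)]
      linarith
    linarith
  have hlt := (hx.others_le_total i).trans_lt hx.total_lt
  have hsum : others x i - ((n : ℝ) - 1) =
      (x k - 1) + ∑ j ∈ (Finset.univ.erase i).erase k, (x j - 1) := by
    rw [Finset.add_sum_erase _ (fun j => x j - 1) (Finset.mem_erase.2 ⟨hki, Finset.mem_univ k⟩),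
      Finset.sum_sub_distrib, others]
    simp only [Finset.sum_const, nsmul_eq_mul, mul_one]
    rw [Finset.card_erase_of_mem (Finset.mem_univ i), Finset.card_univ, Fintype.card_fin,
      Nat.cast_sub (by omega), Nat.cast_one]
  have hrest : |∑ j ∈ (Finset.univ.erase i).erase k, (x j - 1)| ≤ d / 2 := by
    refine (Finset.abs_sum_le_sum_abs _ _).trans ?_
    calc _ ≤ ∑ _j ∈ (Finset.univ.erase i).erase k, d / (2 * (n : ℝ)) :=
          Finset.sum_le_sum fun j hj' => by
            rw [Finset.mem_erase, Finset.mem_erase] at hj'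
            exact (hj j hj'.2.1 hj'.1).le
      _ ≤ ∑ _j : Fin n, d / (2 * (n : ℝ)) :=
          Finset.sum_le_sum_of_subset_of_nonneg (Finset.subset_univ _) fun _ _ _ => by positivity
      _ = d / 2 := by
          simp only [Finset.sum_const, Finset.card_univ, Fintype.card_fin, nsmul_eq_mul]
          field_simp
  have hdist : d / 2 ≤ |others x i - ((n : ℝ) - 1)| := by
    rw [hsum]
    have := abs_sub_abs_le_abs_add (x k - 1) (∑ j ∈ (Finset.univ.erase i).erase k, (x j - 1))
    linarith
  have hbr := abs_bestResponse_sub_one_ge (a := a) hn hs hlt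
  refine hd20.trans ?_
  rw [div_le_iff₀ (by positivity)]
  linarith

/-! ### The lower bound -/

section Dynamics

variable {i : ℕ → Fin n}

theorem Live.dynamics (hn : 3 ≤ n) (hx : Live x) (t : ℕ) :
    Live (dynamics linearCost a x i t) := by
  induction t with
  | zero => exact hx
  | succ t ih => exact ih.move hn (i t)

theorem card_support_dynamics_le (c : ℝ → ℝ) (t : ℕ) :
    (Finset.univ.filter fun j => dynamics c a x i t j ≠ 0).card ≤
      (Finset.univ.filter fun j => x j ≠ 0).card + t := by
  induction t with
  | zero => rfl
  | succ t ih =>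
    have hsub : (Finset.univ.filter fun j => dynamics c a x i (t + 1) j ≠ 0) ⊆
        insert (i t) (Finset.univ.filter fun j => dynamics c a x i t j ≠ 0) := fun j hj => by
      by_cases h : j = i t
      · exact h ▸ Finset.mem_insert_self _ _
      · refine Finset.mem_insert_of_mem ?_
        rw [Finset.mem_filter] at hj ⊢
        rw [Tullock.dynamics, Function.update_of_ne h] at hj
        exact hj
    have := (Finset.card_le_card hsub).trans (Finset.card_insert_le _ _)
    omega

theorem neg_log_ratio_le (hn : 3 ≤ n) (hx : Live x) (t : ℕ) :
    -Real.log ((∑ j, x j) / threshold n linearCost) ≤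
      2 ^ t * -Real.log ((∑ j, dynamics linearCost a x i t j) / threshold n linearCost) := by
  have hκ := four_le_threshold hn
  induction t with
  | zero => simp [Tullock.dynamics]
  | succ t ih =>
    have hy := hx.dynamics (a := a) (i := i) hn t
    have h1 : ((∑ j, Tullock.dynamics linearCost a x i (t + 1) j) / threshold n linearCost) ^ 2 ≤
        (∑ j, Tullock.dynamics linearCost a x i t j) / threshold n linearCost := by
      change ((∑ j, Tullock.move linearCost a (Tullock.dynamics linearCost a x i t) (i t) j) /
        threshold n linearCost) ^ 2 ≤ _
      have h2 := hy.others_pos (i t)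
      rw [hy.total_move hn, div_pow, Real.sq_sqrt (by positivity), sq,
        mul_div_mul_left _ _ (by linarith)]
      exact div_le_div_of_nonneg_right (hy.others_le_total _) (by linarith)
    have h3 := (hx.dynamics (a := a) (i := i) hn (t + 1)).ratio_pos hn
    have h4 := Real.log_le_log (by positivity) h1
    rw [Real.log_pow] at h4
    push_cast at h4
    rw [pow_succ, mul_assoc]
    refine ih.trans (mul_le_mul_of_nonneg_left ?_ (by positivity))
    linarith

theorem Far.dynamics (hn : 3 ≤ n) (hx : Live x) {d : ℝ} (hd : 0 ≤ d) (hd1 : d ≤ 1)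
    (h : Far d x) (t : ℕ) :
    Far (d / ((n : ℝ) ^ 4) ^ t) (dynamics linearCost a x i t) := by
  have hn' : (3 : ℝ) ≤ n := by exact_mod_cast hn
  induction t with
  | zero => simpa [Tullock.dynamics] using h
  | succ t ih =>
    rw [pow_succ, ← div_div]
    have h1 : (1 : ℝ) ≤ ((n : ℝ) ^ 4) ^ t := one_le_pow₀ (one_le_pow₀ (by linarith))
    exact ih.move hn (hx.dynamics hn t) (by positivity) ((div_le_self hd h1).trans hd1) (i t)

end Dynamics

/-- The profile in which two agents produce `γ` and the others nothing. -/
def twoActive (n : ℕ) (γ : ℝ) : Fin n → ℝ := fun j => if (j : ℕ) < 2 then γ else 0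

section TwoActive

variable {γ : ℝ}

theorem twoActive_eq (j : Fin n) : twoActive n γ j = γ ∨ twoActive n γ j = 0 := by
  unfold twoActive
  split_ifs
  · exact Or.inl rfl
  · exact Or.inr rfl

theorem total_twoActive (hn : 3 ≤ n) : ∑ j, twoActive n γ j = 2 * γ := by
  obtain ⟨m, rfl⟩ : ∃ m, n = m + 2 := ⟨n - 2, by omega⟩
  rw [Fin.sum_univ_succ, Fin.sum_univ_succ]
  simp [twoActive]
  ring

theorem card_support_twoActive_le (hn : 3 ≤ n) :
    (Finset.univ.filter fun j => twoActive n γ j ≠ 0).card ≤ 2 := by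
  have hsub : (Finset.univ.filter fun j => twoActive n γ j ≠ 0) ⊆
      {⟨0, by omega⟩, ⟨1, by omega⟩} := fun j hj => by
    have h : (j : ℕ) < 2 := by
      by_contra h
      exact (Finset.mem_filter.1 hj).2 (if_neg h)
    simp only [Finset.mem_insert, Finset.mem_singleton, Fin.ext_iff]
    omega
  exact (Finset.card_le_card hsub).trans Finset.card_le_two

theorem live_twoActive (hn : 3 ≤ n) (hγ : 0 < γ) (hγ4 : γ ≤ 1 / 4) : Live (twoActive n γ) := by
  refine ⟨fun j => ?_, ⟨⟨0, by omega⟩, ⟨1, by omega⟩, by simp, by simpa [twoActive],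
    by simpa [twoActive]⟩, ?_⟩
  · rcases twoActive_eq (γ := γ) j with h | h <;> rw [h]
    exact hγ.le
  · rw [total_twoActive hn]
    linarith [four_le_threshold hn]

theorem far_twoActive (hn : 3 ≤ n) (hγ : 0 < γ) (hγ4 : γ ≤ 1 / 4) :
    Far (1 / 2) (twoActive n γ) := by
  have h : ∀ j, 1 / 2 ≤ |twoActive n γ j - 1| := fun j => by
    rw [abs_sub_comm]
    refine le_trans ?_ (le_abs_self _)
    rcases twoActive_eq (γ := γ) j with h | h <;> rw [h] <;> linarith
  exact ⟨⟨0, by omega⟩, ⟨1, by omega⟩, by simp, h _, h _⟩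

theorem gammaOf_twoActive (hn : 3 ≤ n) (ha : 0 < a) (hγ : 0 < γ) (hγa : γ ≤ a)
    (hγ4 : γ ≤ 1 / 4) : gammaOf linearCost a (twoActive n γ) = γ := by
  have hκ := four_le_threshold hn
  refine IsLeast.csInf_eq ⟨Or.inl (Or.inr ⟨⟨0, by omega⟩, by simpa [twoActive],
    by simp [twoActive]⟩), ?_⟩
  have hx : ∀ j, 0 ≤ twoActive n γ j ∧ twoActive n γ j ≤ 1 / 4 := fun j => by
    rcases twoActive_eq (γ := γ) j with h | h <;> rw [h] <;> constructor <;> linarith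
  rintro w ((rfl | ⟨j, hj, rfl⟩) | (⟨h0, -⟩ | ⟨-, j, hj, rfl⟩))
  · exact hγa
  · rcases twoActive_eq (γ := γ) j with h | h
    · exact h.ge
    · exact absurd h hj.ne'
  · rw [marginal_linearCost le_rfl] at h0
    exact absurd h0 one_ne_zero
  · obtain ⟨h1, h2⟩ := hx j
    refine le_min (by linarith) ?_
    rw [bestResponse_linearCost hn (by linarith) (by linarith), le_sub_iff_add_le]
    refine Real.le_sqrt_of_sq_le ?_
    nlinarith

end TwoActive

theorem logLog_le_of_isApproxEquilibrium (hn : 3 ≤ n) {γ ε ε₁ : ℝ} (hγ : 0 < γ)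
    (hγ4 : γ ≤ 1 / 4) (hε : 0 ≤ ε) (hεε : ε ≤ ε₁) (hε1 : ε₁ < 1) {i : ℕ → Fin n} {t : ℕ}
    (ht : 1 ≤ t)
    (h : IsApproxEquilibrium linearCost ε (dynamics linearCost a (twoActive n γ) i t)) :
    logLog γ ≤ (1 + Real.log (Real.log (4 / (1 - √ε₁) ^ 2))) * t := by
  have hκ := four_le_threshold hn
  have hx := live_twoActive hn hγ hγ4
  obtain ⟨t, rfl⟩ : ∃ m, t = m + 1 := ⟨t - 1, by omega⟩
  have h1 := (hx.dynamics (a := a) (i := i) hn t).le_ratio_of_isApproxEquilibrium hn (i t) hε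
    (hεε.trans_lt hε1) h
  change _ ≤ (∑ j, dynamics linearCost a (twoActive n γ) i (t + 1) j) / _ at h1
  have h2 := neg_log_ratio_le (a := a) (i := i) hn hx (t + 1)
  rw [total_twoActive hn] at h2
  have hr0 := Real.sqrt_nonneg ε₁
  have hr1 : √ε₁ < 1 := by rwa [Real.sqrt_lt' one_pos, one_pow]
  have hr : √ε ≤ √ε₁ := Real.sqrt_le_sqrt hεε
  have hq0 : 0 < (1 - √ε₁) ^ 2 := by
    have : 0 < 1 - √ε₁ := by linarith
    positivity
  have hq1 : (1 - √ε₁) ^ 2 ≤ 1 := by nlinarith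
  have hq : (1 - √ε₁) ^ 2 / 4 ≤ (1 - √ε) ^ 2 / 4 := by
    have : (1 - √ε₁) ^ 2 ≤ (1 - √ε) ^ 2 := pow_le_pow_left₀ (by linarith) (by linarith) 2
    linarith
  have h3 : -Real.log ((∑ j, dynamics linearCost a (twoActive n γ) i (t + 1) j) /
      threshold n linearCost) ≤ Real.log (4 / (1 - √ε₁) ^ 2) := by
    rw [show 4 / (1 - √ε₁) ^ 2 = ((1 - √ε₁) ^ 2 / 4)⁻¹ from (inv_div _ _).symm, Real.log_inv]
    exact neg_le_neg (Real.log_le_log (by positivity) (hq.trans h1))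
  have h4 : Real.log (1 / γ) ≤ -Real.log (2 * γ / threshold n linearCost) := by
    rw [← Real.log_inv, inv_div]
    refine Real.log_le_log (by positivity) ?_
    rw [div_le_div_iff₀ hγ (by positivity)]
    nlinarith
  have hA : 1 ≤ Real.log (4 / (1 - √ε₁) ^ 2) := by
    rw [Real.le_log_iff_exp_le (by positivity), le_div_iff₀ hq0]
    have := Real.exp_one_lt_d9
    nlinarith
  set A := Real.log (4 / (1 - √ε₁) ^ 2)
  have hlogA : 0 ≤ Real.log A := Real.log_nonneg hA
  have hL : 0 < Real.log (1 / γ) := Real.log_pos (by rw [lt_div_iff₀ hγ]; linarith)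
  have h5 : Real.log (1 / γ) ≤ 2 ^ (t + 1) * A :=
    h4.trans (h2.trans (mul_le_mul_of_nonneg_left h3 (by positivity)))
  have h6 := Real.log_le_log hL h5
  rw [Real.log_mul (by positivity) (by linarith), Real.log_pow] at h6
  have hlog2 := Real.log_two_lt_d9
  have ht' : (1 : ℝ) ≤ ((t + 1 : ℕ) : ℝ) := by exact_mod_cast ht
  refine max_le (by positivity) (h6.trans ?_)
  nlinarith

theorem log_le_of_isApproxEquilibrium (hn : 3 ≤ n) {γ ε : ℝ} (hγ : 0 < γ)
    (hγ4 : γ ≤ 1 / 4) (hε : 0 < ε) {i : ℕ → Fin n} {t : ℕ} (ht : 1 ≤ t)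
    (h : IsApproxEquilibrium linearCost ε (dynamics linearCost a (twoActive n γ) i t)) :
    Real.log (1 / ε) / Real.log n ≤ 16 * t := by
  have hn' : (3 : ℝ) ≤ n := by exact_mod_cast hn
  have hx := live_twoActive hn hγ hγ4
  obtain ⟨j, -, -, hj, -⟩ := (far_twoActive hn hγ hγ4).dynamics (a := a) (i := i) hn hx
    (by norm_num) (by norm_num) t
  have h1 := hj.trans ((hx.dynamics hn t).abs_sub_one_le_of_isApproxEquilibrium hn hε.le h j)
  have hlog : 0 < Real.log n := Real.log_pos (by linarith)
  have hr : 0 < √ε := Real.sqrt_pos.2 hε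
  have hn3 : (27 : ℝ) ≤ (n : ℝ) ^ 3 := by
    calc (27 : ℝ) = 3 ^ 3 := by norm_num
      _ ≤ (n : ℝ) ^ 3 := by gcongr
  have h2 : 1 / √ε ≤ (n : ℝ) ^ (4 * t + 4) := by
    rw [div_le_iff₀ (by positivity)] at h1
    rw [div_le_iff₀ hr]
    calc (1 : ℝ) ≤ 18 * (n * √ε * ((n : ℝ) ^ 4) ^ t) := by linarith
      _ ≤ (n : ℝ) ^ 3 * (n * √ε * ((n : ℝ) ^ 4) ^ t) :=
          mul_le_mul_of_nonneg_right (by linarith) (by positivity)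
      _ = (n : ℝ) ^ (4 * t + 4) * √ε := by ring
  have h3 : 1 / ε ≤ ((n : ℝ) ^ (4 * t + 4)) ^ 2 := by
    have : 1 / ε = (1 / √ε) ^ 2 := by rw [div_pow, Real.sq_sqrt hε.le, one_pow]
    rw [this]
    gcongr
  have h4 := Real.log_le_log (by positivity) h3
  rw [Real.log_pow, Real.log_pow] at h4
  rw [div_le_iff₀ hlog]
  have ht' : (1 : ℝ) ≤ t := by exact_mod_cast ht
  push_cast at h4
  nlinarith

theorem le_three_mul_of_isApproxEquilibrium (hn : 3 ≤ n) {γ ε : ℝ} (hγ : 0 < γ)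
    (hγ4 : γ ≤ 1 / 4) (hε : 0 ≤ ε) (hε1 : ε < 1) {i : ℕ → Fin n} {t : ℕ}
    (h : IsApproxEquilibrium linearCost ε (dynamics linearCost a (twoActive n γ) i t)) :
    n ≤ 3 * t := by
  have hx := (live_twoActive hn hγ hγ4).dynamics (a := a) (i := i) hn t
  have h1 := card_support_dynamics_le (a := a) (x := twoActive n γ) (i := i) linearCost t
  rw [Finset.filter_true_of_mem fun j _ => hx.ne_zero_of_isApproxEquilibrium hn hε hε1 h j,
    Finset.card_univ, Fintype.card_fin] at h1
  have h2 := card_support_twoActive_le (γ := γ) hn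
  omega

end Linear

end Tullock

theorem theorem4 :
    (∃ C : ℝ, 0 < C ∧
      ∀ (n : ℕ), 3 ≤ n →
      ∀ (a : ℝ), 0 < a → a < 1 →
      ∀ (c : ℝ → ℝ), Tullock.IsCost c →
      ∀ (ε : ℝ), 0 < ε → ε < 1 →
      ∀ (K : ℝ), Tullock.LipschitzNearOne c K ε →
      ∀ (x₀ : Fin n → ℝ), (∀ j, 0 ≤ x₀ j) →
      ∃ (i : ℕ → Fin n) (t : ℕ),
        (t : ℝ) ≤ C * (Tullock.logLog (Tullock.gammaOf c a x₀) + n * Real.log (n * K / ε)) ∧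
        Tullock.IsApproxEquilibrium c ε (Tullock.dynamics c a x₀ i t)) ∧
    (∀ (ε₁ : ℝ), 0 < ε₁ → ε₁ < 1 →
      ∃ C : ℝ, 0 < C ∧
      ∀ (n : ℕ), 3 ≤ n →
      ∀ (a : ℝ), 0 < a → a < 1 →
      ∀ (ε : ℝ), 0 < ε → ε ≤ ε₁ →
      ∀ (γ : ℝ), 0 < γ → γ ≤ a → γ ≤ 1 / 4 →
      ∀ (K : ℝ), 1 ≤ K →
      ∃ (c : ℝ → ℝ) (x₀ : Fin n → ℝ),
        Tullock.IsCost c ∧ 0 < Tullock.marginal c 0 ∧ Tullock.LipschitzNearOne c K ε ∧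
        (∀ j, 0 ≤ x₀ j) ∧ Tullock.gammaOf c a x₀ = γ ∧
        ∀ (i : ℕ → Fin n) (t : ℕ),
          Tullock.IsApproxEquilibrium c ε (Tullock.dynamics c a x₀ i t) →
          C * (n + Tullock.logLog γ + Real.log (1 / ε) / Real.log n) ≤ t) := by
  refine ⟨⟨27, by norm_num, fun n hn a ha ha1 c hc ε hε hε1 K hK x₀ hx =>
    Tullock.exists_fast_selection hn ha ha1 hc hε hε1 hK hx⟩, fun ε₁ hε₁0 hε₁ => ?_⟩
  -- the maximum with `0` makes the positivity of `20 + A` immediate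
  set A : ℝ := max 0 (Real.log (Real.log (4 / (1 - √ε₁) ^ 2)))
  have hA : 0 ≤ A := le_max_left _ _
  refine ⟨1 / (20 + A), by positivity, fun n hn a ha ha1 ε hε hεε γ hγ hγa hγ4 K hK =>
    ⟨Tullock.linearCost, Tullock.twoActive n γ, Tullock.isCost_linearCost, ?_,
      fun z _ w _ => le_mul_of_one_le_left (abs_nonneg _) hK,
      (Tullock.live_twoActive hn hγ hγ4).nonneg,
      Tullock.gammaOf_twoActive hn ha hγ hγa hγ4, fun i t h => ?_⟩⟩
  · rw [Tullock.marginal_linearCost le_rfl]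
    exact one_pos
  have h1 := Tullock.le_three_mul_of_isApproxEquilibrium hn hγ hγ4 hε.le (hεε.trans_lt hε₁) h
  have ht : 1 ≤ t := by omega
  have h2 := Tullock.logLog_le_of_isApproxEquilibrium hn hγ hγ4 hε.le hεε hε₁ ht h
  have h3 := Tullock.log_le_of_isApproxEquilibrium hn hγ hγ4 hε ht h
  have h4 : (n : ℝ) ≤ 3 * t := by exact_mod_cast h1
  have h5 := mul_le_mul_of_nonneg_right
    (le_max_right 0 (Real.log (Real.log (4 / (1 - √ε₁) ^ 2)))) (Nat.cast_nonneg (α := ℝ) t)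
  rw [one_div_mul_eq_div, div_le_iff₀ (by positivity)]
  change _ ≤ A * (t : ℝ) at h5
  linarith
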